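/- Let $1<p<\infty$ and $\frac1p+\frac1q=1$. For $0<\gamma<1$ let $Ti(p,\gamma)$ be the completion of the space $c_{00}$ of finitely supported real sequences under the norm determined by the implicit equation $$\|a\|=\max\Big\{\|a\|_\infty,\ \gamma\,\sup\frac{\sum_{j=1}^n\|E_ja\|}{n^{1/q}}\Big\},$$ where the supremum is over all $n\ge1$ and all finite sets of natural numbers $E_1<\dots<E_n$, and $E_ja$ is the restriction of $a$ to $E_j$; let $(e_i)$ be its unit vector basis. A block basis of $(e_i)$ is a sequence of non-zero vectors $y_n=\sum_{k=p_n+1}^{p_{n+1}}a_ke_k$ with $p_1<p_2<\cdots$. Two sequences $(x_j)$ and $(y_j)$ are equivalent if, for every real sequence $(a_j)$, the series $\sum_j a_jx_j$ converges if and only if $\sum_j a_jy_j$ converges. A sequence is a subsymmetric basic sequence if it is an unconditional Schauder basis of its closed linear span and is equivalent to all of its subsequences. Then there is $\gamma_0=\gamma_0(p)>0$ such that, for every $\gamma\in(0,1)$ with $\gamma<\gamma_0$, the basis $(e_i)$ of $Ti(p,\gamma)$ has continuum many pairwise non-equivalent subsymmetric block bases. -/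

import Mathlib

/-! ### Basic sequences in real normed spaces -/

section BasicSequences

variable {X : Type*} [NormedAddCommGroup X] [NormedSpace ℝ X]
variable {Y : Type*} [NormedAddCommGroup Y] [NormedSpace ℝ Y]

/-- The series `∑ aⱼ xⱼ` converges in `X`, in the sense that its sequence of partial sums does. -/
def SeriesConverges (x : ℕ → X) (a : ℕ → ℝ) : Prop :=
  ∃ s : X, Filter.Tendsto (fun n => ∑ j ∈ Finset.range n, a j • x j) Filter.atTop (nhds s)

/-- Two (basic) sequences are equivalent if `∑ aⱼ xⱼ` converges exactly when `∑ aⱼ yⱼ` does. -/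
def SeqEquivalent (x : ℕ → X) (y : ℕ → Y) : Prop :=
  ∀ a : ℕ → ℝ, SeriesConverges x a ↔ SeriesConverges y a

/-- `x` is an unconditional basic sequence: it is an unconditional Schauder basis of its closed
linear span. -/
def IsUnconditionalBasicSequence (x : ℕ → X) : Prop :=
  ∃ b : UnconditionalSchauderBasis ℕ ℝ (Submodule.span ℝ (Set.range x)).topologicalClosure,
    ∀ n, ((b n : (Submodule.span ℝ (Set.range x)).topologicalClosure) : X) = x n

/-- A subsymmetric basic sequence: an unconditional basic sequence that is equivalent to all of
its subsequences. -/
def IsSubsymmetric (x : ℕ → X) : Prop :=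
  IsUnconditionalBasicSequence x ∧ ∀ φ : ℕ → ℕ, StrictMono φ → SeqEquivalent x (x ∘ φ)

/-- `y` is a block basis with respect to `x`: the `yₙ` are non-zero linear combinations of the
`xₖ` over consecutive intervals of indices. (Sequences are indexed from `0`, so that the interval
`pₙ + 1, …, pₙ₊₁` becomes `pₙ, …, pₙ₊₁ - 1`.) -/
def IsBlockBasis (x y : ℕ → X) : Prop :=
  ∃ (p : ℕ → ℕ) (a : ℕ → ℝ), StrictMono p ∧
    ∀ n, y n ≠ 0 ∧ y n = ∑ k ∈ Finset.Ico (p n) (p (n + 1)), a k • x k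

end BasicSequences

/-! ### The Tirilman norm on finitely supported sequences -/

noncomputable section Tirilman

/-- The sets `E₁ < E₂ < ⋯ < Eₙ` are successive. Empty sets are allowed; they contribute nothing to
the sums below, so leaving them out only increases the quotients of the Tirilman norm. -/
def Successive {n : ℕ} (E : Fin n → Finset ℕ) : Prop :=
  ∀ i j, i < j → ∀ k ∈ E i, ∀ l ∈ E j, k < l

/-- The restriction `E a` of a finitely supported sequence `a` to a finite set `E`. -/
def restrictTo (E : Finset ℕ) (a : ℕ →₀ ℝ) : ℕ →₀ ℝ := a.filter (· ∈ E)

/-- The supremum norm on `c₀₀`. -/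
def supNorm (a : ℕ →₀ ℝ) : ℝ := ⨆ i, |a i|

/-- All quotients `(∑ⱼ N (Eⱼ a)) / n ^ (1 / q)` over `n ≥ 1` and successive `E₁ < ⋯ < Eₙ`, where
`1 / p + 1 / q = 1`. -/
def tirilmanQuotients (p : ℝ) (N : (ℕ →₀ ℝ) → ℝ) (a : ℕ →₀ ℝ) : Set ℝ :=
  {r | ∃ (n : ℕ) (E : Fin n → Finset ℕ), 1 ≤ n ∧ Successive E ∧
    r = (∑ j, N (restrictTo (E j) a)) / (n : ℝ) ^ (1 / p.conjExponent)}

/-- The right-hand side of the implicit equation of the Tirilman norm. -/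
def tirilmanStep (p γ : ℝ) (N : (ℕ →₀ ℝ) → ℝ) (a : ℕ →₀ ℝ) : ℝ :=
  max (supNorm a) (γ * sSup (tirilmanQuotients p N a))

/-- The recursive sequence of norms whose limit is the Tirilman norm. -/
def tirilmanIter (p γ : ℝ) : ℕ → (ℕ →₀ ℝ) → ℝ
  | 0 => supNorm
  | k + 1 => tirilmanStep p γ (tirilmanIter p γ k)

/-- The Tirilman norm on `c₀₀`, the limit (and supremum) of the increasing recursive sequence of
norms. It solves the implicit equation, see `tirilmanNorm_eq`. -/
def tirilmanNorm (p γ : ℝ) (a : ℕ →₀ ℝ) : ℝ := ⨆ k, tirilmanIter p γ k a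

/-! #### It is a norm -/

/-- The `ℓ₁` norm on `c₀₀`, only used as an upper bound. -/
def oneNorm (a : ℕ →₀ ℝ) : ℝ := ∑ i ∈ a.support, |a i|

theorem restrictTo_apply (E : Finset ℕ) (a : ℕ →₀ ℝ) (i : ℕ) :
    restrictTo E a i = if i ∈ E then a i else 0 := by
  simp [restrictTo, Finsupp.filter_apply]

theorem restrictTo_add (E : Finset ℕ) (a b : ℕ →₀ ℝ) :
    restrictTo E (a + b) = restrictTo E a + restrictTo E b := Finsupp.filter_add

theorem restrictTo_smul (E : Finset ℕ) (c : ℝ) (a : ℕ →₀ ℝ) :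
    restrictTo E (c • a) = c • restrictTo E a := Finsupp.filter_smul

theorem oneNorm_nonneg (a : ℕ →₀ ℝ) : 0 ≤ oneNorm a :=
  Finset.sum_nonneg fun _ _ => abs_nonneg _

theorem abs_le_oneNorm (a : ℕ →₀ ℝ) (i : ℕ) : |a i| ≤ oneNorm a := by
  by_cases h : i ∈ a.support
  · exact Finset.single_le_sum (f := fun i => |a i|) (fun _ _ => abs_nonneg _) h
  · rw [Finsupp.notMem_support_iff.1 h, abs_zero]
    exact oneNorm_nonneg a

theorem bddAbove_abs (a : ℕ →₀ ℝ) : BddAbove (Set.range fun i => |a i|) :=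
  ⟨oneNorm a, by rintro _ ⟨i, rfl⟩; exact abs_le_oneNorm a i⟩

theorem abs_le_supNorm (a : ℕ →₀ ℝ) (i : ℕ) : |a i| ≤ supNorm a := le_ciSup (bddAbove_abs a) i

theorem supNorm_nonneg (a : ℕ →₀ ℝ) : 0 ≤ supNorm a := (abs_nonneg _).trans (abs_le_supNorm a 0)

theorem supNorm_le_oneNorm (a : ℕ →₀ ℝ) : supNorm a ≤ oneNorm a := ciSup_le (abs_le_oneNorm a)

theorem supNorm_add_le (a b : ℕ →₀ ℝ) : supNorm (a + b) ≤ supNorm a + supNorm b :=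
  ciSup_le fun i => (abs_add_le (a i) (b i)).trans
    (add_le_add (abs_le_supNorm a i) (abs_le_supNorm b i))

theorem supNorm_smul (c : ℝ) (a : ℕ →₀ ℝ) : supNorm (c • a) = |c| * supNorm a := by
  simp only [supNorm, Finsupp.smul_apply, smul_eq_mul, abs_mul]
  exact (Real.mul_iSup_of_nonneg (abs_nonneg c) _).symm

theorem oneNorm_restrictTo (E : Finset ℕ) (a : ℕ →₀ ℝ) :
    oneNorm (restrictTo E a) = ∑ i ∈ a.support.filter (· ∈ E), |a i| := by
  unfold oneNorm
  have hs : (restrictTo E a).support = a.support.filter (· ∈ E) := by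
    ext i
    simp [restrictTo_apply, and_comm]
  rw [hs]
  refine Finset.sum_congr rfl fun i hi => ?_
  rw [restrictTo_apply, if_pos (Finset.mem_filter.1 hi).2]

theorem sum_oneNorm_restrictTo_le {n : ℕ} {E : Fin n → Finset ℕ} (hE : Successive E)
    (a : ℕ →₀ ℝ) : ∑ j, oneNorm (restrictTo (E j) a) ≤ oneNorm a := by
  classical
  simp only [oneNorm_restrictTo]
  rw [← Finset.sum_biUnion]
  · refine Finset.sum_le_sum_of_subset_of_nonneg ?_ fun _ _ _ => abs_nonneg _
    exact Finset.biUnion_subset.2 fun j _ => Finset.filter_subset _ _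
  · intro i _ j _ hij
    refine Finset.disjoint_left.2 fun k hk hk' => ?_
    have h1 := (Finset.mem_filter.1 hk).2
    have h2 := (Finset.mem_filter.1 hk').2
    rcases lt_or_gt_of_ne hij with h | h
    · exact lt_irrefl _ (hE i j h k h1 k h2)
    · exact lt_irrefl _ (hE j i h k h2 k h1)

/-- Seminorms on `c₀₀` that are dominated by the `ℓ₁` norm. -/
structure GoodNorm (N : (ℕ →₀ ℝ) → ℝ) : Prop where
  nonneg : ∀ a, 0 ≤ N a
  le_oneNorm : ∀ a, N a ≤ oneNorm a
  add_le : ∀ a b, N (a + b) ≤ N a + N b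
  smul : ∀ (c : ℝ) a, N (c • a) = |c| * N a

theorem goodNorm_supNorm : GoodNorm supNorm :=
  ⟨supNorm_nonneg, supNorm_le_oneNorm, supNorm_add_le, supNorm_smul⟩

theorem one_le_rpow_conj {p : ℝ} (hp : 1 < p) {n : ℕ} (hn : 1 ≤ n) :
    1 ≤ (n : ℝ) ^ (1 / p.conjExponent) := by
  refine Real.one_le_rpow (by exact_mod_cast hn) ?_
  rw [Real.conjExponent]
  have : 0 < p - 1 := by linarith
  positivity

theorem tirilmanQuotients_le {p : ℝ} (hp : 1 < p) {N : (ℕ →₀ ℝ) → ℝ} (hN : GoodNorm N)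
    (a : ℕ →₀ ℝ) {r : ℝ} (hr : r ∈ tirilmanQuotients p N a) : r ≤ oneNorm a := by
  obtain ⟨n, E, hn, hE, rfl⟩ := hr
  have h0 : 0 ≤ ∑ j, N (restrictTo (E j) a) := Finset.sum_nonneg fun _ _ => hN.nonneg _
  exact (div_le_self h0 (one_le_rpow_conj hp hn)).trans
    ((Finset.sum_le_sum fun _ _ => hN.le_oneNorm _).trans (sum_oneNorm_restrictTo_le hE a))

theorem bddAbove_tirilmanQuotients {p : ℝ} (hp : 1 < p) {N : (ℕ →₀ ℝ) → ℝ} (hN : GoodNorm N)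
    (a : ℕ →₀ ℝ) : BddAbove (tirilmanQuotients p N a) :=
  ⟨oneNorm a, fun _ hr => tirilmanQuotients_le hp hN a hr⟩

theorem tirilmanQuotients_nonempty (p : ℝ) (N : (ℕ →₀ ℝ) → ℝ) (a : ℕ →₀ ℝ) :
    (tirilmanQuotients p N a).Nonempty :=
  ⟨_, 1, fun _ => ∅, le_rfl, fun _ _ _ k hk => absurd hk (Finset.notMem_empty k), rfl⟩

theorem sSup_tirilmanQuotients_smul (p : ℝ) {N : (ℕ →₀ ℝ) → ℝ} (hN : GoodNorm N)
    (c : ℝ) (a : ℕ →₀ ℝ) : sSup (tirilmanQuotients p N (c • a)) =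
      |c| * sSup (tirilmanQuotients p N a) := by
  rw [← smul_eq_mul, ← Real.sSup_smul_of_nonneg (abs_nonneg c)]
  congr 1
  have key : ∀ (n : ℕ) (E : Fin n → Finset ℕ),
      (∑ j, N (restrictTo (E j) (c • a))) / (n : ℝ) ^ (1 / p.conjExponent) =
        |c| • ((∑ j, N (restrictTo (E j) a)) / (n : ℝ) ^ (1 / p.conjExponent)) := by
    intro n E
    simp only [restrictTo_smul, hN.smul, ← Finset.mul_sum, smul_eq_mul, mul_div_assoc]
  ext r
  constructor
  · rintro ⟨n, E, hn, hE, rfl⟩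
    exact ⟨_, ⟨n, E, hn, hE, rfl⟩, (key n E).symm⟩
  · rintro ⟨_, ⟨n, E, hn, hE, rfl⟩, rfl⟩
    exact ⟨n, E, hn, hE, (key n E).symm⟩

theorem goodNorm_tirilmanStep {p γ : ℝ} (hp : 1 < p) (hγ0 : 0 < γ) (hγ1 : γ < 1)
    {N : (ℕ →₀ ℝ) → ℝ} (hN : GoodNorm N) : GoodNorm (tirilmanStep p γ N) where
  nonneg a := (supNorm_nonneg a).trans (le_max_left _ _)
  le_oneNorm a := by
    refine max_le (supNorm_le_oneNorm a) ?_
    have h : sSup (tirilmanQuotients p N a) ≤ oneNorm a :=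
      csSup_le (tirilmanQuotients_nonempty p N a) fun r hr => tirilmanQuotients_le hp hN a hr
    nlinarith [oneNorm_nonneg a]
  add_le a b := by
    refine max_le ((supNorm_add_le a b).trans (add_le_add (le_max_left _ _) (le_max_left _ _))) ?_
    have h : sSup (tirilmanQuotients p N (a + b)) ≤
        sSup (tirilmanQuotients p N a) + sSup (tirilmanQuotients p N b) := by
      refine csSup_le (tirilmanQuotients_nonempty p N _) ?_
      rintro _ ⟨n, E, hn, hE, rfl⟩
      have ha := le_csSup (bddAbove_tirilmanQuotients hp hN a) ⟨n, E, hn, hE, rfl⟩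
      have hb := le_csSup (bddAbove_tirilmanQuotients hp hN b) ⟨n, E, hn, hE, rfl⟩
      refine le_trans ?_ (add_le_add ha hb)
      rw [← add_div, ← Finset.sum_add_distrib]
      refine div_le_div_of_nonneg_right (Finset.sum_le_sum fun j _ => ?_)
        (Real.rpow_nonneg (Nat.cast_nonneg n) _)
      rw [restrictTo_add]
      exact hN.add_le _ _
    calc γ * sSup (tirilmanQuotients p N (a + b))
        ≤ γ * (sSup (tirilmanQuotients p N a) + sSup (tirilmanQuotients p N b)) :=
          mul_le_mul_of_nonneg_left h hγ0.le
      _ = γ * sSup (tirilmanQuotients p N a) + γ * sSup (tirilmanQuotients p N b) := mul_add _ _ _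
      _ ≤ _ := add_le_add (le_max_right _ _) (le_max_right _ _)
  smul c a := by
    rw [tirilmanStep, tirilmanStep, supNorm_smul, sSup_tirilmanQuotients_smul p hN,
      mul_max_of_nonneg _ _ (abs_nonneg c)]
    ring_nf

section

variable {p γ : ℝ}

theorem goodNorm_tirilmanIter (hp : 1 < p) (hγ0 : 0 < γ) (hγ1 : γ < 1) (k : ℕ) :
    GoodNorm (tirilmanIter p γ k) := by
  induction k with
  | zero => exact goodNorm_supNorm
  | succ k ih => exact goodNorm_tirilmanStep hp hγ0 hγ1 ih

theorem bddAbove_tirilmanIter (hp : 1 < p) (hγ0 : 0 < γ) (hγ1 : γ < 1) (a : ℕ →₀ ℝ) :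
    BddAbove (Set.range fun k => tirilmanIter p γ k a) :=
  ⟨oneNorm a, by rintro _ ⟨k, rfl⟩; exact (goodNorm_tirilmanIter hp hγ0 hγ1 k).le_oneNorm a⟩

theorem tirilmanIter_le_tirilmanNorm (hp : 1 < p) (hγ0 : 0 < γ) (hγ1 : γ < 1) (k : ℕ)
    (a : ℕ →₀ ℝ) : tirilmanIter p γ k a ≤ tirilmanNorm p γ a :=
  le_ciSup (bddAbove_tirilmanIter hp hγ0 hγ1 a) k

theorem goodNorm_tirilmanNorm (hp : 1 < p) (hγ0 : 0 < γ) (hγ1 : γ < 1) :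
    GoodNorm (tirilmanNorm p γ) where
  nonneg a := (supNorm_nonneg a).trans (tirilmanIter_le_tirilmanNorm hp hγ0 hγ1 0 a)
  le_oneNorm a := ciSup_le fun k => (goodNorm_tirilmanIter hp hγ0 hγ1 k).le_oneNorm a
  add_le a b := ciSup_le fun k => ((goodNorm_tirilmanIter hp hγ0 hγ1 k).add_le a b).trans
    (add_le_add (tirilmanIter_le_tirilmanNorm hp hγ0 hγ1 k a)
      (tirilmanIter_le_tirilmanNorm hp hγ0 hγ1 k b))
  smul c a := by
    simp only [tirilmanNorm, (goodNorm_tirilmanIter hp hγ0 hγ1 _).smul]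
    exact (Real.mul_iSup_of_nonneg (abs_nonneg c) _).symm

theorem supNorm_le_tirilmanNorm (hp : 1 < p) (hγ0 : 0 < γ) (hγ1 : γ < 1) (a : ℕ →₀ ℝ) :
    supNorm a ≤ tirilmanNorm p γ a := tirilmanIter_le_tirilmanNorm hp hγ0 hγ1 0 a

theorem tirilmanStep_mono (hp : 1 < p) (hγ0 : 0 < γ) {N M : (ℕ →₀ ℝ) → ℝ} (hM : GoodNorm M)
    (h : ∀ a, N a ≤ M a) (a : ℕ →₀ ℝ) : tirilmanStep p γ N a ≤ tirilmanStep p γ M a := by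
  refine max_le_max le_rfl (mul_le_mul_of_nonneg_left ?_ hγ0.le)
  refine csSup_le (tirilmanQuotients_nonempty p N _) ?_
  rintro _ ⟨n, E, hn, hE, rfl⟩
  refine le_trans ?_ (le_csSup (bddAbove_tirilmanQuotients hp hM a) ⟨n, E, hn, hE, rfl⟩)
  exact div_le_div_of_nonneg_right (Finset.sum_le_sum fun j _ => h _)
    (Real.rpow_nonneg (Nat.cast_nonneg n) _)

theorem tirilmanIter_mono (hp : 1 < p) (hγ0 : 0 < γ) (hγ1 : γ < 1) (a : ℕ →₀ ℝ) :
    Monotone fun k => tirilmanIter p γ k a := by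
  have h : ∀ k, ∀ a, tirilmanIter p γ k a ≤ tirilmanIter p γ (k + 1) a := by
    intro k
    induction k with
    | zero => exact fun a => le_max_left _ _
    | succ k ih =>
      exact tirilmanStep_mono hp hγ0 (goodNorm_tirilmanIter hp hγ0 hγ1 (k + 1)) ih
  exact monotone_nat_of_le_succ fun k => h k a

/-- The implicit equation
`‖a‖ = max (‖a‖_∞, γ sup (∑ⱼ ‖Eⱼ a‖) / n ^ (1 / q))` of the Tirilman norm. -/
theorem tirilmanNorm_eq (hp : 1 < p) (hγ0 : 0 < γ) (hγ1 : γ < 1) (a : ℕ →₀ ℝ) :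
    tirilmanNorm p γ a = max (supNorm a) (γ * sSup (tirilmanQuotients p (tirilmanNorm p γ) a)) := by
  refine le_antisymm (ciSup_le fun k => ?_)
    (max_le (supNorm_le_tirilmanNorm hp hγ0 hγ1 a) ?_)
  · cases k with
    | zero => exact le_max_left _ _
    | succ k =>
      exact tirilmanStep_mono hp hγ0 (goodNorm_tirilmanNorm hp hγ0 hγ1)
        (tirilmanIter_le_tirilmanNorm hp hγ0 hγ1 k) a
  · rw [← le_div_iff₀' hγ0]
    refine csSup_le (tirilmanQuotients_nonempty p _ _) ?_
    rintro _ ⟨n, E, hn, hE, rfl⟩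
    have hlim : Filter.Tendsto
        (fun k => (∑ j, tirilmanIter p γ k (restrictTo (E j) a)) / (n : ℝ) ^ (1 / p.conjExponent))
        Filter.atTop (nhds ((∑ j, tirilmanNorm p γ (restrictTo (E j) a)) /
          (n : ℝ) ^ (1 / p.conjExponent))) :=
      (tendsto_finsetSum _ fun j _ => tendsto_atTop_ciSup (tirilmanIter_mono hp hγ0 hγ1 _)
        (bddAbove_tirilmanIter hp hγ0 hγ1 _)).div_const _
    refine le_of_tendsto' hlim fun k => ?_
    rw [le_div_iff₀' hγ0]
    refine le_trans ?_ (tirilmanIter_le_tirilmanNorm hp hγ0 hγ1 (k + 1) a)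
    exact le_trans (mul_le_mul_of_nonneg_left (le_csSup (bddAbove_tirilmanQuotients hp
      (goodNorm_tirilmanIter hp hγ0 hγ1 k) a) ⟨n, E, hn, hE, rfl⟩) hγ0.le) (le_max_right _ _)

end

/-! ### The Tirilman space -/

/-- The space `c₀₀` of finitely supported real sequences, to be equipped with the Tirilman norm,
for `1 < p < ∞` and `0 < γ < 1`. -/
def TirilmanC00 (_p : Set.Ioi (1 : ℝ)) (_γ : Set.Ioo (0 : ℝ) 1) : Type := ℕ →₀ ℝ

variable (p : Set.Ioi (1 : ℝ)) (γ : Set.Ioo (0 : ℝ) 1)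

instance : AddCommGroup (TirilmanC00 p γ) := inferInstanceAs (AddCommGroup (ℕ →₀ ℝ))

instance : Module ℝ (TirilmanC00 p γ) := inferInstanceAs (Module ℝ (ℕ →₀ ℝ))

/-- A finitely supported sequence as an element of `TirilmanC00 p γ` (the identity map). -/
def TirilmanC00.of : (ℕ →₀ ℝ) ≃ₗ[ℝ] TirilmanC00 p γ := LinearEquiv.refl ℝ (ℕ →₀ ℝ)

instance : Norm (TirilmanC00 p γ) := ⟨fun a => tirilmanNorm (p : ℝ) (γ : ℝ) a⟩

theorem tirilmanCore : NormedSpace.Core ℝ (TirilmanC00 p γ) where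
  norm_nonneg a := (goodNorm_tirilmanNorm p.2 γ.2.1 γ.2.2).nonneg a
  norm_smul c a := (goodNorm_tirilmanNorm p.2 γ.2.1 γ.2.2).smul c a
  norm_triangle a b := (goodNorm_tirilmanNorm p.2 γ.2.1 γ.2.2).add_le a b
  norm_eq_zero_iff a := by
    constructor
    · intro h
      refine Finsupp.ext fun i => abs_eq_zero.1 (le_antisymm ?_ (abs_nonneg _))
      exact ((abs_le_supNorm a i).trans
        (supNorm_le_tirilmanNorm p.2 γ.2.1 γ.2.2 a)).trans_eq h
    · rintro rfl
      have h : tirilmanNorm (p : ℝ) (γ : ℝ) 0 = 0 := by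
        simpa using (goodNorm_tirilmanNorm p.2 γ.2.1 γ.2.2).smul 0 0
      exact h

instance : NormedAddCommGroup (TirilmanC00 p γ) := NormedAddCommGroup.ofCore (tirilmanCore p γ)

instance : NormedSpace ℝ (TirilmanC00 p γ) := NormedSpace.ofCore (tirilmanCore p γ)

theorem TirilmanC00.norm_of (a : ℕ →₀ ℝ) :
    ‖TirilmanC00.of p γ a‖ = tirilmanNorm (p : ℝ) (γ : ℝ) a := rfl

/-- The Tirilman space `Ti(p, γ)`: the completion of `c₀₀` in the Tirilman norm. -/
abbrev Tirilman : Type := UniformSpace.Completion (TirilmanC00 p γ)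

/-- The canonical basis `(eᵢ)` of `Ti(p, γ)`: the unit vectors. -/
def tirilmanBasis (i : ℕ) : Tirilman p γ :=
  (TirilmanC00.of p γ (Finsupp.single i 1) : UniformSpace.Completion (TirilmanC00 p γ))

end Tirilman

/-! Let q be the conjugate exponent and ρ(n) the largest power of 2 dividing n. The norm has an
upper ℓ_p estimate with constant one, and sums of successive pieces have a lower one when the pieces
have comparable norms. It is nevertheless far from the ℓ_p norm: for γ ≤ 1/(2q), the vector ∑
ρ(n)^(1/p) e_n over [2^K, 2^(K+1)) has norm at most 2^(K/p) (`tirilmanNorm_le_of_le_ruler`), while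
the p-th power of its ℓ_p norm is at least (K+2) 2^K / 2 (`mul_two_pow_le_sum_ruler`).

This gap closes when e_n is replaced by a constant vector of length 2^K and ℓ_p norm one. The n-th
constant vector, scaled by ρ(n)^(1/p), splits into ρ(n) equal pieces of norm at least γ, so the
whole sum has norm at least γ² (∑ ρ(n))^(1/p). Normalised ruler coefficients on a dyadic interval
thus detect constant parts of length 2^K inside the blocks.

For a set A containing 0, the blocks are longer and longer truncations of one profile vector, with a
constant part of length 2^(K k) and p-th power mass `wt k` for each k in A. Spreading invariance and
the small tails of the profile make every such block basis subsymmetric (`Layout.isSubsymmetric`).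
The k-th test vector has norm at least γ² if k ∈ A (`Layout.le_tirilmanNorm_test`). If k ∉ A, its
norm is at most 2 · 2^(-k/p) (`Layout.tirilmanNorm_sum_test_le`): the earlier parts occupy few
coordinates compared with K k, and the later parts have tiny mass.

If A \ B is infinite, gluing the test vectors for k ∈ A \ B gives a series that diverges for A and
converges for B. It remains to take continuum many sets containing 0 that differ pairwise by
infinitely many elements (`spreadSet`). -/

noncomputable section

/-! ### Lattice and spreading properties of the Tirilman norm -/

/-- `f` is dominated by `g` if a strictly increasing rearrangement of the support of `f` puts it
below `g` in absolute value. -/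
def Dominated (f g : ℕ →₀ ℝ) : Prop :=
  ∃ τ : ℕ → ℕ, StrictMonoOn τ f.support ∧ ∀ i ∈ f.support, |f i| ≤ |g (τ i)|

theorem one_div_conjExponent {p : ℝ} (hp : 1 < p) : 1 / p.conjExponent = 1 - 1 / p := by
  have h1 : p - 1 ≠ 0 := by linarith
  have h0 : p ≠ 0 := by linarith
  rw [Real.conjExponent]
  field_simp

section

variable {p γ : ℝ}

/-- A map that is strictly increasing on the support of `f` carries successive sets meeting that
support to successive sets, so every quotient of `f` is bounded by a quotient of `g`. This gives
unconditionality and invariance under spreading at once. -/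
theorem tirilmanIter_le_of_dominated (hp : 1 < p) (hγ0 : 0 < γ) (hγ1 : γ < 1) (k : ℕ) :
    ∀ {f g : ℕ →₀ ℝ}, Dominated f g → tirilmanIter p γ k f ≤ tirilmanIter p γ k g := by
  have hsup : ∀ {f g : ℕ →₀ ℝ}, Dominated f g → supNorm f ≤ supNorm g := by
    rintro f g ⟨τ, -, hτ⟩
    refine ciSup_le fun i => ?_
    by_cases hi : i ∈ f.support
    · exact (hτ i hi).trans (abs_le_supNorm g _)
    · rw [Finsupp.notMem_support_iff.1 hi, abs_zero]
      exact supNorm_nonneg g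
  induction k with
  | zero => exact hsup
  | succ k ih =>
    intro f g hfg
    refine max_le_max (hsup hfg) (mul_le_mul_of_nonneg_left ?_ hγ0.le)
    obtain ⟨τ, hmono, hτ⟩ := hfg
    refine csSup_le (tirilmanQuotients_nonempty p _ _) ?_
    rintro _ ⟨n, E, hn, hE, rfl⟩
    set E' : Fin n → Finset ℕ := fun j => (f.support.filter (· ∈ E j)).image τ with hE'
    have hs : Successive E' := by
      intro i j hij k hk l hl
      simp only [hE', Finset.mem_image, Finset.mem_filter] at hk hl
      obtain ⟨k, ⟨hk, hki⟩, rfl⟩ := hk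
      obtain ⟨l, ⟨hl, hlj⟩, rfl⟩ := hl
      exact hmono hk hl (hE i j hij k hki l hlj)
    refine le_trans ?_ (le_csSup (bddAbove_tirilmanQuotients hp
      (goodNorm_tirilmanIter hp hγ0 hγ1 k) g) ⟨n, E', hn, hs, rfl⟩)
    refine div_le_div_of_nonneg_right (Finset.sum_le_sum fun j _ => ih ?_)
      (Real.rpow_nonneg (Nat.cast_nonneg n) _)
    have hmem : ∀ i ∈ (restrictTo (E j) f).support, i ∈ f.support ∧ i ∈ E j := by
      intro i hi
      rw [Finsupp.mem_support_iff, restrictTo_apply] at hi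
      by_cases h : i ∈ E j
      · exact ⟨Finsupp.mem_support_iff.2 (by simpa [h] using hi), h⟩
      · simp [h] at hi
    refine ⟨τ, fun i hi i' hi' h => hmono (hmem i hi).1 (hmem i' hi').1 h, fun i hi => ?_⟩
    obtain ⟨h1, h2⟩ := hmem i hi
    rw [restrictTo_apply, restrictTo_apply, if_pos h2, if_pos]
    · exact hτ i h1
    · exact Finset.mem_image_of_mem τ (Finset.mem_filter.2 ⟨h1, h2⟩)

theorem tirilmanNorm_le_of_dominated (hp : 1 < p) (hγ0 : 0 < γ) (hγ1 : γ < 1)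
    {f g : ℕ →₀ ℝ} (h : Dominated f g) : tirilmanNorm p γ f ≤ tirilmanNorm p γ g :=
  ciSup_mono (bddAbove_tirilmanIter hp hγ0 hγ1 g) fun k =>
    tirilmanIter_le_of_dominated hp hγ0 hγ1 k h

theorem abs_le_tirilmanNorm (hp : 1 < p) (hγ0 : 0 < γ) (hγ1 : γ < 1) (a : ℕ →₀ ℝ) (i : ℕ) :
    |a i| ≤ tirilmanNorm p γ a :=
  (abs_le_supNorm a i).trans (supNorm_le_tirilmanNorm hp hγ0 hγ1 a)

theorem tirilmanNorm_zero (hp : 1 < p) (hγ0 : 0 < γ) (hγ1 : γ < 1) :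
    tirilmanNorm p γ 0 = 0 := by
  simpa using (goodNorm_tirilmanNorm hp hγ0 hγ1).smul 0 0

theorem tirilmanNorm_sum_le (hp : 1 < p) (hγ0 : 0 < γ) (hγ1 : γ < 1) {ι : Type*} (s : Finset ι)
    (f : ι → ℕ →₀ ℝ) : tirilmanNorm p γ (∑ i ∈ s, f i) ≤ ∑ i ∈ s, tirilmanNorm p γ (f i) :=
  Finset.le_sum_of_subadditive _ (tirilmanNorm_zero hp hγ0 hγ1).le
    (goodNorm_tirilmanNorm hp hγ0 hγ1).add_le s f

/-- The lower estimate for sums of successive pieces. -/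
theorem card_rpow_le_tirilmanNorm (hp : 1 < p) (hγ0 : 0 < γ) (hγ1 : γ < 1) {ι : Type*}
    [LinearOrder ι] (J : Finset ι) (E : ι → Finset ℕ)
    (hE : ∀ i ∈ J, ∀ j ∈ J, i < j → ∀ k ∈ E i, ∀ l ∈ E j, k < l) (a : ℕ →₀ ℝ) {δ : ℝ}
    (hδ : ∀ j ∈ J, δ ≤ tirilmanNorm p γ (restrictTo (E j) a)) :
    γ * δ * (J.card : ℝ) ^ (1 / p) ≤ tirilmanNorm p γ a := by
  have hp0 : p ≠ 0 := by linarith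
  rcases J.eq_empty_or_nonempty with rfl | hJ
  · rw [Finset.card_empty, Nat.cast_zero, Real.zero_rpow (one_div_ne_zero hp0), mul_zero]
    exact (goodNorm_tirilmanNorm hp hγ0 hγ1).nonneg a
  set e := J.orderEmbOfFin rfl
  have hc : 1 ≤ J.card := Finset.card_pos.2 hJ
  have hc0 : (0 : ℝ) < J.card := by exact_mod_cast hc
  have hs : Successive fun j => E (e j) := fun i j hij =>
    hE _ (J.orderEmbOfFin_mem rfl i) _ (J.orderEmbOfFin_mem rfl j) (e.strictMono hij)
  have h1 := le_csSup (bddAbove_tirilmanQuotients hp (goodNorm_tirilmanNorm hp hγ0 hγ1) a)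
    ⟨J.card, fun j => E (e j), hc, hs, rfl⟩
  have h2 : (J.card : ℝ) * δ ≤ ∑ j, tirilmanNorm p γ (restrictTo (E (e j)) a) := by
    have := Finset.card_nsmul_le_sum (Finset.univ : Finset (Fin J.card))
      (fun j => tirilmanNorm p γ (restrictTo (E (e j)) a)) δ
      fun j _ => hδ _ (J.orderEmbOfFin_mem rfl j)
    simpa using this
  rw [tirilmanNorm_eq hp hγ0 hγ1 a]
  refine le_trans ?_ (le_max_right _ _)
  rw [mul_assoc]
  refine mul_le_mul_of_nonneg_left (le_trans ?_ h1) hγ0.le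
  rw [le_div_iff₀ (Real.rpow_pos_of_pos hc0 _), one_div_conjExponent hp, mul_assoc,
    ← Real.rpow_add hc0]
  simpa [mul_comm] using h2

/-- The lower estimate for vectors with large coordinates on a given set. -/
theorem flat_le_tirilmanNorm (hp : 1 < p) (hγ0 : 0 < γ) (hγ1 : γ < 1) (J : Finset ℕ)
    (a : ℕ →₀ ℝ) {δ : ℝ} (hδ : ∀ j ∈ J, δ ≤ |a j|) :
    γ * δ * (J.card : ℝ) ^ (1 / p) ≤ tirilmanNorm p γ a := by
  refine card_rpow_le_tirilmanNorm hp hγ0 hγ1 J (fun j => {j}) ?_ a fun j hj => ?_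
  · intro i _ j _ hij k hk l hl
    rw [Finset.mem_singleton.1 hk, Finset.mem_singleton.1 hl]
    exact hij
  · refine (hδ j hj).trans ?_
    have := abs_le_tirilmanNorm hp hγ0 hγ1 (restrictTo {j} a) j
    rwa [restrictTo_apply, if_pos (Finset.mem_singleton_self j)] at this

/-! ### The upper `ℓ_p` estimate -/

/-- The `p`-th power of the `ℓ_p` norm. -/
def powNorm (p : ℝ) (a : ℕ →₀ ℝ) : ℝ := ∑ i ∈ a.support, |a i| ^ p

theorem powNorm_nonneg (p : ℝ) (a : ℕ →₀ ℝ) : 0 ≤ powNorm p a :=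
  Finset.sum_nonneg fun _ _ => Real.rpow_nonneg (abs_nonneg _) _

theorem powNorm_restrictTo (p : ℝ) (E : Finset ℕ) (a : ℕ →₀ ℝ) :
    powNorm p (restrictTo E a) = ∑ i ∈ a.support.filter (· ∈ E), |a i| ^ p := by
  unfold powNorm
  have hs : (restrictTo E a).support = a.support.filter (· ∈ E) := by
    ext i
    simp [restrictTo_apply, and_comm]
  rw [hs]
  refine Finset.sum_congr rfl fun i hi => ?_
  rw [restrictTo_apply, if_pos (Finset.mem_filter.1 hi).2]

theorem sum_powNorm_restrictTo_le (p : ℝ) {n : ℕ} {E : Fin n → Finset ℕ} (hE : Successive E)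
    (a : ℕ →₀ ℝ) : ∑ j, powNorm p (restrictTo (E j) a) ≤ powNorm p a := by
  classical
  simp only [powNorm_restrictTo]
  rw [← Finset.sum_biUnion]
  · refine Finset.sum_le_sum_of_subset_of_nonneg ?_
      fun _ _ _ => Real.rpow_nonneg (abs_nonneg _) _
    exact Finset.biUnion_subset.2 fun j _ => Finset.filter_subset _ _
  · intro i _ j _ hij
    refine Finset.disjoint_left.2 fun k hk hk' => ?_
    have h1 := (Finset.mem_filter.1 hk).2
    have h2 := (Finset.mem_filter.1 hk').2
    rcases lt_or_gt_of_ne hij with h | h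
    · exact lt_irrefl _ (hE i j h k h1 k h2)
    · exact lt_irrefl _ (hE j i h k h2 k h1)

/-- By Hölder, n numbers have sum at most n^(1/q) times their ℓ_p norm, and the p-th powers of the
ℓ_p norms of disjoint pieces add up to at most that of the whole. Each step of the recursion
therefore preserves the bound, as γ < 1. -/
theorem tirilmanIter_le_powNorm (hp : 1 < p) (hγ0 : 0 < γ) (hγ1 : γ < 1) (k : ℕ) :
    ∀ a : ℕ →₀ ℝ, tirilmanIter p γ k a ≤ powNorm p a ^ (1 / p) := by
  have hp0 : 0 < p := by linarith
  have hsup : ∀ a : ℕ →₀ ℝ, supNorm a ≤ powNorm p a ^ (1 / p) := by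
    intro a
    refine ciSup_le fun i => ?_
    by_cases hi : i ∈ a.support
    · have h := Finset.single_le_sum (f := fun i => |a i| ^ p)
        (fun _ _ => Real.rpow_nonneg (abs_nonneg _) _) hi
      have h2 := Real.rpow_le_rpow (Real.rpow_nonneg (abs_nonneg _) _) h
        (one_div_nonneg.2 hp0.le)
      rwa [← Real.rpow_mul (abs_nonneg _), mul_one_div_cancel hp0.ne', Real.rpow_one] at h2
    · rw [Finsupp.notMem_support_iff.1 hi, abs_zero]
      exact Real.rpow_nonneg (powNorm_nonneg p a) _
  induction k with
  | zero => exact hsup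
  | succ k ih =>
    intro a
    refine max_le (hsup a) ?_
    have hle : sSup (tirilmanQuotients p (tirilmanIter p γ k) a) ≤ powNorm p a ^ (1 / p) := by
      refine csSup_le (tirilmanQuotients_nonempty p _ _) ?_
      rintro _ ⟨n, E, hn, hE, rfl⟩
      have hn0 : (0 : ℝ) < n := by exact_mod_cast hn
      rw [div_le_iff₀ (Real.rpow_pos_of_pos hn0 _), one_div_conjExponent hp]
      have hx : ∀ j, 0 ≤ powNorm p (restrictTo (E j) a) ^ (1 / p) := fun j =>
        Real.rpow_nonneg (powNorm_nonneg p _) _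
      refine (Finset.sum_le_sum fun j _ => ih (restrictTo (E j) a)).trans ?_
      have h := Real.rpow_sum_le_const_mul_sum_rpow (Finset.univ : Finset (Fin n))
        (fun j => powNorm p (restrictTo (E j) a) ^ (1 / p)) hp.le
      have hpow : ∀ j, |powNorm p (restrictTo (E j) a) ^ (1 / p)| ^ p =
          powNorm p (restrictTo (E j) a) := by
        intro j
        rw [abs_of_nonneg (hx j), ← Real.rpow_mul (powNorm_nonneg p _), one_div_mul_cancel hp0.ne',
          Real.rpow_one]
      simp only [hpow, Finset.card_univ, Fintype.card_fin] at h
      rw [Finset.sum_congr rfl fun j _ => abs_of_nonneg (hx j)] at h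
      have h2 := h.trans (mul_le_mul_of_nonneg_left (sum_powNorm_restrictTo_le p hE a)
        (Real.rpow_nonneg hn0.le _))
      have h0 : 0 ≤ ∑ j, powNorm p (restrictTo (E j) a) ^ (1 / p) :=
        Finset.sum_nonneg fun j _ => hx j
      have h3 := Real.rpow_le_rpow (Real.rpow_nonneg h0 _) h2 (one_div_nonneg.2 hp0.le)
      rw [← Real.rpow_mul h0, mul_one_div_cancel hp0.ne', Real.rpow_one,
        Real.mul_rpow (Real.rpow_nonneg hn0.le _) (powNorm_nonneg p a),
        ← Real.rpow_mul hn0.le, mul_comm] at h3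
      rwa [show 1 - 1 / p = (p - 1) * (1 / p) by field_simp]
    calc γ * sSup (tirilmanQuotients p (tirilmanIter p γ k) a)
        ≤ 1 * powNorm p a ^ (1 / p) := by
          refine mul_le_mul hγ1.le hle ?_ zero_le_one
          exact Real.sSup_nonneg fun r hr => by
            obtain ⟨n, E, -, -, rfl⟩ := hr
            exact div_nonneg (Finset.sum_nonneg fun _ _ =>
              (goodNorm_tirilmanIter hp hγ0 hγ1 k).nonneg _) (Real.rpow_nonneg n.cast_nonneg _)
      _ = _ := one_mul _

theorem tirilmanNorm_le_powNorm (hp : 1 < p) (hγ0 : 0 < γ) (hγ1 : γ < 1) (a : ℕ →₀ ℝ) :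
    tirilmanNorm p γ a ≤ powNorm p a ^ (1 / p) :=
  ciSup_le fun k => tirilmanIter_le_powNorm hp hγ0 hγ1 k a

end


/-! ### The ruler sequence -/

/-- The largest power of `2` dividing `n`. -/
def ruler (n : ℕ) : ℕ := 2 ^ padicValNat 2 n

theorem ruler_pos (n : ℕ) : 0 < ruler n := pow_pos two_pos _

/-- An interval without multiples of 2^v lies between two consecutive ones, where there is room for
at most 2^(v-u) multiples of 2^u. -/
theorem card_mul_pow_le_of_dvd {s t u v : ℕ} (huv : u ≤ v)
    (hI : ∀ n ∈ Finset.Ico s t, ¬ 2 ^ v ∣ n) {T : Finset ℕ} (hT : T ⊆ Finset.Ico s t)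
    (hu : ∀ n ∈ T, 2 ^ u ∣ n) : T.card * 2 ^ u ≤ 2 ^ v := by
  have hdiv : ∀ n ∈ Finset.Ico s t, n / 2 ^ v = s / 2 ^ v := by
    intro n hn
    obtain ⟨h1, h2⟩ := Finset.mem_Ico.1 hn
    by_contra hne
    have hlt : s / 2 ^ v < n / 2 ^ v := lt_of_le_of_ne (Nat.div_le_div_right h1) (Ne.symm hne)
    have h3 : 2 ^ v * (n / 2 ^ v) ≤ n := Nat.mul_div_le n _
    have h4 : s < 2 ^ v * (s / 2 ^ v + 1) := Nat.lt_mul_div_succ s (by positivity)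
    have h5 : 2 ^ v * (s / 2 ^ v + 1) ≤ 2 ^ v * (n / 2 ^ v) := Nat.mul_le_mul_left _ hlt
    exact hI (2 ^ v * (n / 2 ^ v)) (Finset.mem_Ico.2 ⟨by omega, by omega⟩) (Dvd.intro _ rfl)
  have hpow : 2 ^ v = 2 ^ u * 2 ^ (v - u) := by rw [← pow_add]; congr 1; omega
  have hcard : T.card ≤ 2 ^ (v - u) := by
    have hmaps : ∀ n ∈ T, n / 2 ^ u ∈ Finset.Ico (s / 2 ^ v * 2 ^ (v - u))
        (s / 2 ^ v * 2 ^ (v - u) + 2 ^ (v - u)) := by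
      intro n hn
      have h1 := hdiv n (hT hn)
      rw [hpow, ← Nat.div_div_eq_div_mul, ← hpow] at h1
      have h2 := Nat.div_add_mod (n / 2 ^ u) (2 ^ (v - u))
      have h3 := Nat.mod_lt (n / 2 ^ u) (show 2 ^ (v - u) > 0 by positivity)
      rw [h1, mul_comm] at h2
      rw [Finset.mem_Ico]
      omega
    have hinj : Set.InjOn (fun n => n / 2 ^ u) (T : Set ℕ) := by
      intro a ha b hb hab
      have h1 := Nat.div_mul_cancel (hu a ha)
      have h2 := Nat.div_mul_cancel (hu b hb)
      simp only at hab
      rw [← h1, ← h2, hab]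
    have := Finset.card_le_card_of_injOn _ hmaps hinj
    simpa using this
  rw [hpow, mul_comm]
  exact Nat.mul_le_mul_left _ hcard

/-- The sum of the `1 / p`-th powers of numbers that satisfy a weak type estimate. -/
theorem sum_rpow_le_of_weak {p : ℝ} (hp : 1 < p) {d : ℕ → ℝ} (hd : ∀ n, 0 ≤ d n) {M : ℝ}
    (hM : 0 ≤ M) (m : ℕ) : ∀ T : Finset ℕ, T.card = m →
    (∀ T' ⊆ T, ∀ n ∈ T', (∀ l ∈ T', d n ≤ d l) → T'.card * d n ≤ M) →
    ∑ n ∈ T, d n ^ (1 / p) ≤ M ^ (1 / p) * p.conjExponent * (m : ℝ) ^ (1 - 1 / p) := by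
  have hp0 : 0 < p := by linarith
  have hx0 : 0 < 1 - 1 / p := by
    rw [sub_pos, div_lt_one hp0]
    exact hp
  have hq : p.conjExponent = 1 / (1 - 1 / p) := by
    rw [← one_div_conjExponent hp, one_div_one_div]
  induction m with
  | zero =>
    intro T hT _
    rw [Finset.card_eq_zero.1 hT, Finset.sum_empty, Nat.cast_zero, Real.zero_rpow hx0.ne', mul_zero]
  | succ m ih =>
    intro T hT hw
    have hne : T.Nonempty := Finset.card_pos.1 (by omega)
    obtain ⟨n, hn, hmin⟩ := T.exists_min_image d hne
    have h1 := ih (T.erase n) (by rw [Finset.card_erase_of_mem hn, hT]; rfl)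
      fun T' hT' => hw T' (hT'.trans (Finset.erase_subset _ _))
    have h2 := hw T subset_rfl n hn hmin
    rw [hT] at h2
    have hm : (0 : ℝ) < (m + 1 : ℕ) := by positivity
    have h3 : d n ≤ M / (m + 1 : ℕ) := by rwa [le_div_iff₀ hm, mul_comm]
    have h4 : d n ^ (1 / p) ≤ M ^ (1 / p) * ((m + 1 : ℕ) : ℝ) ^ (-(1 / p)) := by
      refine (Real.rpow_le_rpow (hd n) h3 (one_div_nonneg.2 hp0.le)).trans_eq ?_
      rw [Real.div_rpow hM hm.le, Real.rpow_neg hm.le, div_eq_mul_inv]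
    -- Bernoulli's inequality for the exponent 1/q < 1: the increment of x^(1/q) from m to m + 1
    -- pays for the smallest term, the factor q cancelling the derivative constant 1/q.
    have h5 : (m : ℝ) ^ (1 - 1 / p) ≤ ((m + 1 : ℕ) : ℝ) ^ (1 - 1 / p) -
        (1 - 1 / p) * ((m + 1 : ℕ) : ℝ) ^ (-(1 / p)) := by
      have hb := rpow_one_add_le_one_add_mul_self (s := -(1 / (m + 1 : ℕ)))
        (p := 1 - 1 / p) (by
          rw [neg_le_neg_iff, div_le_one hm]
          push_cast
          linarith [(Nat.cast_nonneg m : (0 : ℝ) ≤ m)]) hx0.le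
          (by linarith [one_div_pos.2 hp0])
      have hmm : (m : ℝ) = (m + 1 : ℕ) * (1 + -(1 / (m + 1 : ℕ))) := by
        field_simp
        push_cast
        ring
      have hnn : (0 : ℝ) ≤ 1 + -(1 / (m + 1 : ℕ)) := by
        rw [← sub_eq_add_neg, sub_nonneg, div_le_one hm]
        push_cast
        linarith [(Nat.cast_nonneg m : (0 : ℝ) ≤ m)]
      have he : ((m + 1 : ℕ) : ℝ) ^ (-(1 / p)) =
          ((m + 1 : ℕ) : ℝ) ^ (1 - 1 / p) * (1 / (m + 1 : ℕ)) := by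
        rw [show -(1 / p) = (1 - 1 / p) - 1 by ring, Real.rpow_sub hm, Real.rpow_one]
        ring
      calc (m : ℝ) ^ (1 - 1 / p)
          = ((m + 1 : ℕ) : ℝ) ^ (1 - 1 / p) * (1 + -(1 / (m + 1 : ℕ))) ^ (1 - 1 / p) := by
            rw [← Real.mul_rpow hm.le hnn, ← hmm]
        _ ≤ ((m + 1 : ℕ) : ℝ) ^ (1 - 1 / p) * (1 + (1 - 1 / p) * -(1 / (m + 1 : ℕ))) :=
            mul_le_mul_of_nonneg_left hb (Real.rpow_nonneg hm.le _)
        _ = _ := by rw [he]; ring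
    have hC : 0 ≤ M ^ (1 / p) * p.conjExponent :=
      mul_nonneg (Real.rpow_nonneg hM _) (by rw [hq]; exact one_div_nonneg.2 hx0.le)
    have h6 := mul_le_mul_of_nonneg_left h5 hC
    have h7 : M ^ (1 / p) * p.conjExponent * ((1 - 1 / p) * ((m + 1 : ℕ) : ℝ) ^ (-(1 / p))) =
        M ^ (1 / p) * ((m + 1 : ℕ) : ℝ) ^ (-(1 / p)) := by
      rw [hq, mul_assoc, ← mul_assoc (1 / (1 - 1 / p)), one_div_mul_cancel hx0.ne', one_mul]
    rw [← Finset.add_sum_erase T _ hn]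
    rw [mul_sub, h7] at h6
    linarith

/-- On such an interval the ruler sequence is of weak type ℓ_1 with constant 2^(v+1): places where
it is at least 2^u are multiples of 2^u, and these are counted by `card_mul_pow_le_of_dvd`. -/
theorem sum_ruler_rpow_le {p : ℝ} (hp : 1 < p) {s t v : ℕ}
    (hI : ∀ n ∈ Finset.Ico s t, ¬ 2 ^ (v + 1) ∣ n) {T : Finset ℕ} (hT : T ⊆ Finset.Ico s t) :
    ∑ n ∈ T, (ruler n : ℝ) ^ (1 / p) ≤
      ((2 : ℝ) ^ (v + 1)) ^ (1 / p) * p.conjExponent * (T.card : ℝ) ^ (1 - 1 / p) := by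
  refine sum_rpow_le_of_weak hp (fun n => Nat.cast_nonneg _) (by positivity) _ T rfl ?_
  intro T' hT' n hn hmin
  have hne : ∀ l ∈ Finset.Ico s t, l ≠ 0 := by
    rintro l hl rfl
    exact hI 0 hl (dvd_zero _)
  have hdvd : ∀ l ∈ T', 2 ^ padicValNat 2 n ∣ l := by
    intro l hl
    have h1 : ruler n ≤ ruler l := by exact_mod_cast hmin l hl
    rw [padicValNat_dvd_iff_le (hne l (hT (hT' hl)))]
    exact (Nat.pow_le_pow_iff_right one_lt_two).1 h1
  have hv : padicValNat 2 n ≤ v + 1 := by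
    by_contra hlt
    exact hI n (hT (hT' hn)) ((pow_dvd_pow 2 (not_le.1 hlt).le).trans (hdvd n hn))
  exact_mod_cast card_mul_pow_le_of_dvd hv hI (hT'.trans hT) hdvd

/-! ### The Tirilman norm of ruler vectors -/

section

variable {p γ : ℝ}

/-- Inductively, each piece of `f` is bounded by the largest value of ρ^(1/p) on the interval it
spans. These maxima are attained at distinct points, so m pieces sum to at most 2^((v+1)/p) q
m^(1/q); the factor γ · 2^(1/p) · q ≤ 1 brings this back to 2^(v/p), with no loss from one step to
the next. -/
theorem tirilmanIter_le_of_le_ruler (hp : 1 < p) (hγ0 : 0 < γ) (hγ1 : γ < 1)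
    (hγ : γ * (2 * p.conjExponent) ≤ 1) (k : ℕ) : ∀ (s t v : ℕ),
    (∀ n ∈ Finset.Ico s t, ¬ 2 ^ (v + 1) ∣ n) → ∀ f : ℕ →₀ ℝ, f.support ⊆ Finset.Ico s t →
    (∀ n, |f n| ≤ (ruler n : ℝ) ^ (1 / p)) → tirilmanIter p γ k f ≤ ((2 : ℝ) ^ v) ^ (1 / p) := by
  have hp0 : 0 < p := by linarith
  have hip : 0 ≤ 1 / p := one_div_nonneg.2 hp0.le
  have hsup : ∀ (s t v : ℕ),
      (∀ n ∈ Finset.Ico s t, ¬ 2 ^ (v + 1) ∣ n) → ∀ f : ℕ →₀ ℝ, f.support ⊆ Finset.Ico s t →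
      (∀ n, |f n| ≤ (ruler n : ℝ) ^ (1 / p)) → supNorm f ≤ ((2 : ℝ) ^ v) ^ (1 / p) := by
    intro s t v hI f hs hf
    refine ciSup_le fun n => ?_
    by_cases hn : n ∈ f.support
    · refine (hf n).trans (Real.rpow_le_rpow (Nat.cast_nonneg _) ?_ hip)
      have h0 : n ≠ 0 := by
        rintro rfl
        exact hI 0 (hs hn) (dvd_zero _)
      have h1 := hI n (hs hn)
      rw [padicValNat_dvd_iff_le h0, not_le, Nat.lt_succ_iff] at h1
      exact_mod_cast Nat.pow_le_pow_right two_pos h1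
    · rw [Finsupp.notMem_support_iff.1 hn, abs_zero]
      positivity
  induction k with
  | zero => exact hsup
  | succ k ih =>
    intro s t v hI f hs hf
    refine max_le (hsup s t v hI f hs hf) ?_
    rw [← le_div_iff₀' hγ0]
    refine csSup_le (tirilmanQuotients_nonempty p _ _) ?_
    rintro _ ⟨m, E, hm, hE, rfl⟩
    have hm0 : (0 : ℝ) < m := by exact_mod_cast hm
    set F : Fin m → Finset ℕ := fun j => f.support.filter (· ∈ E j) with hF
    have hFE : ∀ j, ∀ n ∈ F j, n ∈ f.support ∧ n ∈ E j := fun j n hn => Finset.mem_filter.1 hn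
    have hsupp : ∀ j, (restrictTo (E j) f).support = F j := by
      intro j
      ext i
      simp [hF, restrictTo_apply, and_comm]
    have hpt : ∀ j, (F j).Nonempty → ∃ n, (∃ a ∈ F j, a ≤ n) ∧ (∃ b ∈ F j, n ≤ b) ∧
        tirilmanIter p γ k (restrictTo (E j) f) ≤ (ruler n : ℝ) ^ (1 / p) := by
      intro j hj
      have hle : (F j).min' hj ≤ (F j).max' hj := (F j).min'_le_max' hj
      -- The maximum is taken over the whole interval spanned by the piece, since the induction
      -- hypothesis concerns intervals; the maximiser need not belong to the piece itself.
      obtain ⟨n, hn, hmax⟩ := (Finset.Ico ((F j).min' hj) ((F j).max' hj + 1)).exists_max_image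
        (padicValNat 2) ⟨(F j).min' hj, Finset.mem_Ico.2 ⟨le_rfl, by omega⟩⟩
      obtain ⟨hn1, hn2⟩ := Finset.mem_Ico.1 hn
      refine ⟨n, ⟨_, (F j).min'_mem hj, hn1⟩, ⟨_, (F j).max'_mem hj, by omega⟩, ?_⟩
      have h := ih ((F j).min' hj) ((F j).max' hj + 1) (padicValNat 2 n) ?_
        (restrictTo (E j) f) ?_ ?_
      · simpa [ruler] using h
      · intro l hl hdvd
        -- Zero must be excluded: every power of 2 divides it, while `padicValNat 2 0 = 0`.
        have h0 : l ≠ 0 := by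
          rintro rfl
          have h1 := Finset.mem_Ico.1 hl
          have h2 : (F j).min' hj = 0 := by omega
          have h3 := (hFE j _ ((F j).min'_mem hj)).1
          rw [h2] at h3
          exact hI 0 (hs h3) (dvd_zero _)
        have := hmax l hl
        rw [padicValNat_dvd_iff_le h0] at hdvd
        omega
      · rw [hsupp]
        intro l hl
        exact Finset.mem_Ico.2 ⟨(F j).min'_le l hl, Nat.lt_succ_of_le ((F j).le_max' l hl)⟩
      · intro l
        rw [restrictTo_apply]
        split_ifs
        · exact hf l
        · simpa using Real.rpow_nonneg (Nat.cast_nonneg (ruler l)) (1 / p)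
    choose! x hx1 hx2 hx3 using hpt
    set J : Finset (Fin m) := Finset.univ.filter fun j => (F j).Nonempty with hJ
    have hJmem : ∀ j ∈ J, (F j).Nonempty := fun j hj => (Finset.mem_filter.1 hj).2
    have hlt : ∀ i ∈ J, ∀ j ∈ J, i < j → x i < x j := by
      intro i hi j hj hij
      obtain ⟨b, hb, hxb⟩ := hx2 i (hJmem i hi)
      obtain ⟨a, ha, hxa⟩ := hx1 j (hJmem j hj)
      exact (hxb.trans_lt (hE i j hij b (hFE i b hb).2 a (hFE j a ha).2)).trans_le hxa
    have hinj : Set.InjOn x (J : Set (Fin m)) := by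
      intro i hi j hj hij
      rcases lt_trichotomy i j with h | h | h
      · exact absurd hij (hlt i hi j hj h).ne
      · exact h
      · exact absurd hij (hlt j hj i hi h).ne'
    have hsum : ∑ j, tirilmanIter p γ k (restrictTo (E j) f) ≤
        ∑ n ∈ J.image x, (ruler n : ℝ) ^ (1 / p) := by
      rw [Finset.sum_image hinj,
        ← Finset.sum_filter_add_sum_filter_not Finset.univ fun j => (F j).Nonempty]
      have hz : ∑ j ∈ Finset.univ.filter (fun j => ¬ (F j).Nonempty),
          tirilmanIter p γ k (restrictTo (E j) f) = 0 := by
        refine Finset.sum_eq_zero fun j hj => ?_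
        have h1 : F j = ∅ := Finset.not_nonempty_iff_eq_empty.1 (Finset.mem_filter.1 hj).2
        rw [← hsupp, Finsupp.support_eq_empty] at h1
        rw [h1]
        simpa using (goodNorm_tirilmanIter hp hγ0 hγ1 k).smul 0 0
      rw [hz, add_zero]
      exact Finset.sum_le_sum fun j hj => hx3 j (hJmem j hj)
    have hT : J.image x ⊆ Finset.Ico s t := by
      intro n hn
      obtain ⟨j, hj, rfl⟩ := Finset.mem_image.1 hn
      obtain ⟨a, ha, hxa⟩ := hx1 j (hJmem j hj)
      obtain ⟨b, hb, hxb⟩ := hx2 j (hJmem j hj)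
      have h1 := Finset.mem_Ico.1 (hs (hFE j a ha).1)
      have h2 := Finset.mem_Ico.1 (hs (hFE j b hb).1)
      exact Finset.mem_Ico.2 ⟨by omega, by omega⟩
    have hcard : (J.image x).card ≤ m :=
      Finset.card_image_le.trans ((Finset.card_le_univ _).trans_eq (Fintype.card_fin m))
    have hq0 : 0 < p.conjExponent := div_pos hp0 (by linarith)
    have hx0 : 0 ≤ 1 - 1 / p := by
      rw [sub_nonneg, div_le_one hp0]
      exact hp.le
    rw [div_le_iff₀ (Real.rpow_pos_of_pos hm0 _), one_div_conjExponent hp]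
    refine hsum.trans ((sum_ruler_rpow_le hp hI hT).trans ?_)
    refine mul_le_mul ?_ (Real.rpow_le_rpow (Nat.cast_nonneg _) (by exact_mod_cast hcard) hx0)
      (Real.rpow_nonneg (Nat.cast_nonneg _) _) (by positivity)
    rw [le_div_iff₀ hγ0, pow_succ, Real.mul_rpow (by positivity) two_pos.le]
    have h2 : (2 : ℝ) ^ (1 / p) ≤ 2 := by
      have := Real.rpow_le_rpow_of_exponent_le (one_le_two (α := ℝ))
        ((div_le_one hp0).2 hp.le)
      simpa using this
    have h3 : (0 : ℝ) ≤ ((2 : ℝ) ^ v) ^ (1 / p) := by positivity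
    calc ((2 : ℝ) ^ v) ^ (1 / p) * 2 ^ (1 / p) * p.conjExponent * γ
        ≤ ((2 : ℝ) ^ v) ^ (1 / p) * 2 * p.conjExponent * γ := by gcongr
      _ = ((2 : ℝ) ^ v) ^ (1 / p) * (γ * (2 * p.conjExponent)) := by ring
      _ ≤ ((2 : ℝ) ^ v) ^ (1 / p) := mul_le_of_le_one_right h3 hγ

/-- The Tirilman norm of the restriction of the `1 / p`-th power of the ruler sequence to an
interval is its largest value. -/
theorem tirilmanNorm_le_of_le_ruler (hp : 1 < p) (hγ0 : 0 < γ) (hγ1 : γ < 1)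
    (hγ : γ * (2 * p.conjExponent) ≤ 1) {s t v : ℕ}
    (hI : ∀ n ∈ Finset.Ico s t, ¬ 2 ^ (v + 1) ∣ n) {f : ℕ →₀ ℝ} (hs : f.support ⊆ Finset.Ico s t)
    (hf : ∀ n, |f n| ≤ (ruler n : ℝ) ^ (1 / p)) :
    tirilmanNorm p γ f ≤ ((2 : ℝ) ^ v) ^ (1 / p) :=
  ciSup_le fun k => tirilmanIter_le_of_le_ruler hp hγ0 hγ1 hγ k s t v hI f hs hf

end

/-! ### Ruler sums over dyadic intervals -/

/-- The dyadic interval `[2 ^ K, 2 ^ (K + 1))`. -/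
def dyadic (K : ℕ) : Finset ℕ := Finset.Ico (2 ^ K) (2 ^ (K + 1))

theorem ruler_two_mul {n : ℕ} (hn : n ≠ 0) : ruler (2 * n) = 2 * ruler n := by
  rw [ruler, padicValNat.mul two_ne_zero hn, padicValNat_self, pow_add, pow_one, ruler]

theorem ruler_two_mul_add_one (n : ℕ) : ruler (2 * n + 1) = 1 := by
  rw [ruler, padicValNat.eq_zero_of_not_dvd (by omega), pow_zero]

/-- Odd numbers contribute 1 each and ρ(2n) = 2ρ(n), so the sums S_K satisfy S_(K+1) = 2 S_K + 2^K.
The factor K + 2 is the logarithmic gain over 2^K on which the construction rests. -/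
theorem mul_two_pow_le_sum_ruler (K : ℕ) :
    (K + 2) * 2 ^ K ≤ 2 * ∑ n ∈ dyadic K, ruler n := by
  have hsplit : ∀ a b : ℕ, 0 < a → a ≤ b → ∑ n ∈ Finset.Ico (2 * a) (2 * b), ruler n =
      2 * ∑ n ∈ Finset.Ico a b, ruler n + (b - a) := by
    intro a b ha hab
    induction b, hab using Nat.le_induction with
    | base => simp
    | succ b hab ih =>
      rw [show 2 * (b + 1) = 2 * b + 1 + 1 by ring, Finset.sum_Ico_succ_top (by omega),
        Finset.sum_Ico_succ_top (by omega), Finset.sum_Ico_succ_top hab, ih,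
        ruler_two_mul_add_one, ruler_two_mul (by omega)]
      omega
  induction K with
  | zero => simp [dyadic, ruler]
  | succ K ih =>
    have h := hsplit (2 ^ K) (2 ^ (K + 1)) (by positivity) (Nat.pow_le_pow_right two_pos K.le_succ)
    rw [dyadic, show 2 ^ (K + 1 + 1) = 2 * 2 ^ (K + 1) by ring, show
      Finset.Ico (2 ^ (K + 1)) (2 * 2 ^ (K + 1)) = Finset.Ico (2 * 2 ^ K) (2 * 2 ^ (K + 1)) by
        rw [pow_succ' 2 K], h]
    have h2 : 2 ^ (K + 1) - 2 ^ K = 2 ^ K := by rw [pow_succ]; omega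
    rw [h2]
    rw [dyadic] at ih
    have : (K + 1 + 2) * 2 ^ (K + 1) = 2 * ((K + 2) * 2 ^ K) + 2 * 2 ^ K := by ring
    omega

theorem not_dvd_of_mem_dyadic {K n : ℕ} (hn : n ∈ dyadic K) : ¬ 2 ^ (K + 1) ∣ n := by
  obtain ⟨h1, h2⟩ := Finset.mem_Ico.1 hn
  exact fun h => absurd (Nat.le_of_dvd (by have := Nat.two_pow_pos K; omega) h) (by omega)

theorem ruler_dvd_of_mem_dyadic {K n : ℕ} (hn : n ∈ dyadic K) : ruler n ∣ 2 ^ K := by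
  have h0 : n ≠ 0 := by
    have := (Finset.mem_Ico.1 hn).1
    have := Nat.two_pow_pos K
    omega
  have h1 := not_dvd_of_mem_dyadic hn
  rw [padicValNat_dvd_iff_le h0, not_le, Nat.lt_succ_iff] at h1
  exact pow_dvd_pow 2 h1


/-! ### Unconditional basic sequences -/

section BasicSequences

variable {X : Type*} [NormedAddCommGroup X] [NormedSpace ℝ X]

/-- The uniform bound on the finite coordinate projections extends to the closed span by continuity.
On the dense linear span the expansions are eventually exact, and density then gives convergence
along the net of finite sets. -/
theorem isUnconditionalBasicSequence_of_biorthogonal {x : ℕ → X} (f : ℕ → StrongDual ℝ X)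
    (hf : ∀ i j, f i (x j) = if i = j then 1 else 0) {C : ℝ} (hC0 : 0 ≤ C)
    (hC : ∀ A : Finset ℕ, ∀ z ∈ Submodule.span ℝ (Set.range x),
      ‖∑ i ∈ A, f i z • x i‖ ≤ C * ‖z‖) : IsUnconditionalBasicSequence x := by
  classical
  set S := Submodule.span ℝ (Set.range x) with hS
  have hmem : ∀ n, x n ∈ S.topologicalClosure := fun n =>
    S.le_topologicalClosure (Submodule.subset_span ⟨n, rfl⟩)
  have hC' : ∀ A : Finset ℕ, ∀ z ∈ S.topologicalClosure,
      ‖∑ i ∈ A, f i z • x i‖ ≤ C * ‖z‖ := by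
    intro A z hz
    have hcl : IsClosed {z : X | ‖∑ i ∈ A, f i z • x i‖ ≤ C * ‖z‖} :=
      isClosed_le (by fun_prop) (by fun_prop)
    exact closure_minimal (s := (S : Set X)) (fun z hz => hC A z hz) hcl hz
  have hfin : ∀ z ∈ S, ∃ A₀ : Finset ℕ, ∀ A, A₀ ⊆ A → ∑ i ∈ A, f i z • x i = z := by
    intro z hz
    induction hz using Submodule.span_induction with
    | mem z hz =>
      obtain ⟨n, rfl⟩ := hz
      refine ⟨{n}, fun A hA => ?_⟩
      simp [hf, Finset.singleton_subset_iff.1 hA]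
    | zero => exact ⟨∅, fun A _ => by simp⟩
    | add y z _ _ hy hz =>
      obtain ⟨A, hA⟩ := hy
      obtain ⟨B, hB⟩ := hz
      refine ⟨A ∪ B, fun D hD => ?_⟩
      simp only [map_add, add_smul, Finset.sum_add_distrib]
      rw [hA D (Finset.union_subset_left hD), hB D (Finset.union_subset_right hD)]
    | smul c z _ hz =>
      obtain ⟨A, hA⟩ := hz
      refine ⟨A, fun D hD => ?_⟩
      simp only [map_smul, smul_assoc, ← Finset.smul_sum]
      rw [hA D hD]
  refine ⟨{ basis := fun n => ⟨x n, hmem n⟩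
            coord := fun n => (f n).comp S.topologicalClosure.subtypeL
            ortho := fun i j => ?_
            expansion := fun v => ?_ }, fun n => rfl⟩
  · simp [hf, Pi.single_apply]
  · have key : HasSum (fun i => f i (v : X) • (⟨x i, hmem i⟩ : S.topologicalClosure)) v := by
      refine Metric.tendsto_atTop.2 fun ε hε => ?_
      have hv : (v : X) ∈ closure (S : Set X) := v.2
      obtain ⟨z, hz, hvz⟩ := Metric.mem_closure_iff.1 hv (ε / (C + 1)) (by positivity)
      obtain ⟨A₀, hA₀⟩ := hfin z hz
      refine ⟨A₀, fun A hA => ?_⟩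
      rw [dist_eq_norm, ← Submodule.norm_coe]
      have h1 : ((∑ i ∈ A, f i (v : X) • (⟨x i, hmem i⟩ : S.topologicalClosure) - v :
          S.topologicalClosure) : X) = ∑ i ∈ A, f i ((v : X) - z) • x i - ((v : X) - z) := by
        have h2 := hA₀ A hA
        simp only [map_sub, sub_smul, Finset.sum_sub_distrib, h2]
        simp
      rw [h1]
      have h3 := hC' A _ (Submodule.sub_mem _ v.2 (S.le_topologicalClosure hz))
      rw [dist_eq_norm, lt_div_iff₀ (by positivity)] at hvz
      calc _ ≤ ‖∑ i ∈ A, f i ((v : X) - z) • x i‖ + ‖(v : X) - z‖ := norm_sub_le _ _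
        _ ≤ C * ‖(v : X) - z‖ + ‖(v : X) - z‖ := by gcongr
        _ = ‖(v : X) - z‖ * (C + 1) := by ring
        _ < ε := hvz
    exact key

theorem isBlockBasis_of_support (e : (ℕ →₀ ℝ) →ₗ[ℝ] X) {w : ℕ → ℕ →₀ ℝ} {P : ℕ → ℕ}
    (hP : StrictMono P)
    (hw : ∀ n, (w n).support ⊆ Finset.Ico (P n) (P (n + 1))) (h0 : ∀ n, e (w n) ≠ 0) :
    IsBlockBasis (fun k => e (Finsupp.single k 1)) fun n => e (w n) := by
  -- As n ≤ P n, a block containing k has index at most k, so this sum picks out its coordinate at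
  -- k.
  refine ⟨P, fun k => ∑ n ∈ Finset.range (k + 1), w n k, hP, fun n => ⟨h0 n, ?_⟩⟩
  have hcoef : ∀ k ∈ Finset.Ico (P n) (P (n + 1)),
      ∑ m ∈ Finset.range (k + 1), w m k = w n k := by
    intro k hk
    obtain ⟨h1, h2⟩ := Finset.mem_Ico.1 hk
    refine Finset.sum_eq_single_of_mem n ?_ fun m _ hmn => ?_
    · exact Finset.mem_range.2 (Nat.lt_succ_of_le ((hP.le_apply (x := n)).trans h1))
    · by_contra hne
      obtain ⟨h3, h4⟩ := Finset.mem_Ico.1 (hw m (Finsupp.mem_support_iff.2 hne))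
      have h5 := hP.lt_iff_lt.1 (h1.trans_lt h4)
      have h6 := hP.lt_iff_lt.1 (h3.trans_lt h2)
      omega
  have hsum : w n = ∑ k ∈ Finset.Ico (P n) (P (n + 1)), w n k • Finsupp.single k (1 : ℝ) := by
    conv_lhs => rw [← (w n).sum_single]
    rw [Finsupp.sum_of_support_subset _ (hw n) _ (by simp)]
    simp
  change e (w n) = _
  conv_lhs => rw [hsum]
  rw [map_sum]
  refine Finset.sum_congr rfl fun k hk => ?_
  rw [map_smul, ← hcoef k hk]

end BasicSequences

/-! ### Finitely supported vectors in the Tirilman space -/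

section

variable (p : Set.Ioi (1 : ℝ)) (γ : Set.Ioo (0 : ℝ) 1)

/-- The inclusion of `c₀₀` in the Tirilman space. -/
def tirilmanEmb : (ℕ →₀ ℝ) →ₗ[ℝ] Tirilman p γ :=
  (UniformSpace.Completion.toComplL (𝕜 := ℝ) (E := TirilmanC00 p γ)).toLinearMap.comp
    (TirilmanC00.of p γ).toLinearMap

theorem norm_tirilmanEmb (a : ℕ →₀ ℝ) :
    ‖tirilmanEmb p γ a‖ = tirilmanNorm (p : ℝ) (γ : ℝ) a :=
  UniformSpace.Completion.norm_coe (TirilmanC00.of p γ a)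

theorem exists_coordinate (s : ℕ) :
    ∃ f : StrongDual ℝ (Tirilman p γ), ∀ a : ℕ →₀ ℝ, f (tirilmanEmb p γ a) = a s := by
  let g : TirilmanC00 p γ →L[ℝ] ℝ :=
    LinearMap.mkContinuous ((Finsupp.lapply s).comp (TirilmanC00.of p γ).symm.toLinearMap) 1
      fun a => by
        rw [one_mul]
        exact abs_le_tirilmanNorm p.2 γ.2.1 γ.2.2 ((TirilmanC00.of p γ).symm a) s
  refine ⟨g.extend (UniformSpace.Completion.toComplL (𝕜 := ℝ) (E := TirilmanC00 p γ)),
    fun a => ?_⟩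
  exact ContinuousLinearMap.extend_eq g UniformSpace.Completion.denseRange_coe
    (UniformSpace.Completion.isUniformInducing_coe _) (TirilmanC00.of p γ a)

/-- Completeness replaces convergence by a Cauchy condition that involves only finitely supported
vectors. -/
theorem seriesConverges_tirilmanEmb_iff (w : ℕ → ℕ →₀ ℝ) (b : ℕ → ℝ) :
    SeriesConverges (fun n => tirilmanEmb p γ (w n)) b ↔ ∀ ε > 0, ∃ M, ∀ m n, M ≤ m → m ≤ n →
      tirilmanNorm (p : ℝ) (γ : ℝ) (∑ j ∈ Finset.Ico m n, b j • w j) < ε := by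
  have hd : ∀ m n, m ≤ n → dist (∑ j ∈ Finset.range n, b j • tirilmanEmb p γ (w j))
      (∑ j ∈ Finset.range m, b j • tirilmanEmb p γ (w j)) =
      tirilmanNorm (p : ℝ) (γ : ℝ) (∑ j ∈ Finset.Ico m n, b j • w j) := by
    intro m n hmn
    rw [dist_eq_norm, ← Finset.sum_Ico_eq_sub _ hmn, ← norm_tirilmanEmb, map_sum]
    simp only [map_smul]
  have h1 : SeriesConverges (fun n => tirilmanEmb p γ (w n)) b ↔
      CauchySeq fun n => ∑ j ∈ Finset.range n, b j • tirilmanEmb p γ (w j) :=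
    ⟨fun ⟨_, h⟩ => h.cauchySeq, cauchySeq_tendsto_of_complete⟩
  rw [h1, Metric.cauchySeq_iff]
  refine forall₂_congr fun ε _ => exists_congr fun M =>
    ⟨fun h m n hm hmn => ?_, fun h m hm n hn => ?_⟩
  · rw [← hd m n hmn]
    exact h n (hm.trans hmn) m hm
  · rcases le_total m n with hmn | hmn
    · rw [dist_comm, hd m n hmn]
      exact h m n hm hmn
    · rw [hd n m hmn]
      exact h n m hn hmn

end


/-! ### Sums of vectors supported on consecutive blocks -/

/-- The vector with coordinates `d 0, d 1, …` on the block `[P n, P (n + 1))`. -/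
def block (P : ℕ → ℕ) (n : ℕ) (d : ℕ → ℝ) : ℕ →₀ ℝ :=
  Finsupp.onFinset (Finset.Ico (P n) (P (n + 1)))
    (fun s => if s ∈ Finset.Ico (P n) (P (n + 1)) then d (s - P n) else 0)
    fun s hs => by
      by_contra h
      exact hs (if_neg h)

theorem block_apply (P : ℕ → ℕ) (n : ℕ) (d : ℕ → ℝ) (s : ℕ) :
    block P n d s = if s ∈ Finset.Ico (P n) (P (n + 1)) then d (s - P n) else 0 := rfl

theorem support_block_subset (P : ℕ → ℕ) (n : ℕ) (d : ℕ → ℝ) :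
    (block P n d).support ⊆ Finset.Ico (P n) (P (n + 1)) :=
  Finsupp.support_onFinset_subset

theorem block_add (P : ℕ → ℕ) (n : ℕ) (d d' : ℕ → ℝ) :
    block P n (fun r => d r + d' r) = block P n d + block P n d' := by
  ext s
  simp only [block_apply, Finsupp.add_apply]
  split_ifs <;> simp

theorem block_smul (P : ℕ → ℕ) (n : ℕ) (c : ℝ) (d : ℕ → ℝ) :
    c • block P n d = block P n fun r => c * d r := by
  ext s
  simp only [block_apply, Finsupp.smul_apply, smul_eq_mul]
  split_ifs <;> simp

theorem block_sum (P : ℕ → ℕ) (n : ℕ) {ι : Type*} (I : Finset ι) (d : ι → ℕ → ℝ) :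
    block P n (fun r => ∑ i ∈ I, d i r) = ∑ i ∈ I, block P n (d i) := by
  ext s
  simp only [block_apply, Finsupp.finsetSum_apply]
  split_ifs <;> simp

section

variable {P : ℕ → ℕ}

theorem StrictMono.block_add_lt (hP : StrictMono P) {m n r r' : ℕ}
    (hr : P m + r < P (m + 1)) (hmn : m < n) :
    P m + r < P n + r' :=
  hr.trans_le ((hP.monotone hmn).trans (Nat.le_add_right _ _))

theorem StrictMono.eq_of_mem_block (hP : StrictMono P) {m n s : ℕ}
    (hm : s ∈ Finset.Ico (P m) (P (m + 1)))
    (hn : s ∈ Finset.Ico (P n) (P (n + 1))) : m = n := by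
  obtain ⟨h1, h2⟩ := Finset.mem_Ico.1 hm
  obtain ⟨h3, h4⟩ := Finset.mem_Ico.1 hn
  have h5 := hP.lt_iff_lt.1 (h1.trans_lt h4)
  have h6 := hP.lt_iff_lt.1 (h3.trans_lt h2)
  omega

theorem sum_block_apply (hP : StrictMono P) {φ : ℕ → ℕ} (hφ : StrictMono φ)
    {G : Finset ℕ} (D : ℕ → ℕ → ℝ) {n r : ℕ}
    (hn : n ∈ G) (hr : P (φ n) + r < P (φ n + 1)) :
    (∑ m ∈ G, block P (φ m) (D m)) (P (φ n) + r) = D n r := by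
  have hmem : P (φ n) + r ∈ Finset.Ico (P (φ n)) (P (φ n + 1)) :=
    Finset.mem_Ico.2 ⟨Nat.le_add_right _ _, hr⟩
  rw [Finsupp.finsetSum_apply, Finset.sum_eq_single_of_mem n hn]
  · rw [block_apply, if_pos hmem, Nat.add_sub_cancel_left]
  · intro m _ hmn
    rw [block_apply, if_neg]
    exact fun h => hmn (hφ.injective (hP.eq_of_mem_block h hmem))

theorem exists_of_mem_support_sum_block {φ : ℕ → ℕ} {G : Finset ℕ}
    {D : ℕ → ℕ → ℝ} {s : ℕ} (hs : s ∈ (∑ m ∈ G, block P (φ m) (D m)).support) :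
    ∃ x : ℕ × ℕ, x.1 ∈ G ∧ P (φ x.1) + x.2 < P (φ x.1 + 1) ∧ s = P (φ x.1) + x.2 ∧
      D x.1 x.2 ≠ 0 := by
  have h := Finsupp.mem_support_iff.1 hs
  rw [Finsupp.finsetSum_apply] at h
  obtain ⟨n, hn, hne⟩ := Finset.exists_ne_zero_of_sum_ne_zero h
  obtain ⟨h1, h2⟩ := Finset.mem_Ico.1 (support_block_subset P _ _ (Finsupp.mem_support_iff.2 hne))
  refine ⟨(n, s - P (φ n)), hn, by simpa [h1] using h2, by simp [h1], ?_⟩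
  rw [block_apply, if_pos (Finset.mem_Ico.2 ⟨h1, h2⟩)] at hne
  exact hne

/-- The r-th place of block `φ n` is sent to the r-th place of block `ψ n`; this respects the order
within a block and between blocks. -/
theorem dominated_sum_block (hP : StrictMono P) {φ ψ : ℕ → ℕ} (hφ : StrictMono φ)
    (hψ : StrictMono ψ)
    {G G' : Finset ℕ} {D D' : ℕ → ℕ → ℝ}
    (h : ∀ n ∈ G, ∀ r, P (φ n) + r < P (φ n + 1) → D n r ≠ 0 →
      n ∈ G' ∧ P (ψ n) + r < P (ψ n + 1) ∧ |D n r| ≤ |D' n r|) :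
    Dominated (∑ m ∈ G, block P (φ m) (D m)) (∑ m ∈ G', block P (ψ m) (D' m)) := by
  have hex := fun s => exists_of_mem_support_sum_block (P := P) (φ := φ) (G := G) (D := D) (s := s)
  choose! x hx1 hx2 hx3 hx4 using hex
  refine ⟨fun s => P (ψ (x s).1) + (x s).2, fun s hs s' hs' hlt => ?_, fun s hs => ?_⟩
  · have h1 := h _ (hx1 s hs) _ (hx2 s hs) (hx4 s hs)
    rcases lt_trichotomy (x s).1 (x s').1 with hlt' | heq | hgt
    · exact hP.block_add_lt h1.2.1 (hψ hlt')
    · have h2 := hx3 s hs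
      have h3 := hx3 s' hs'
      rw [heq] at h2
      simp only [heq]
      omega
    · have h2 := hP.block_add_lt (r' := (x s).2) (hx2 s' hs') (hφ hgt)
      rw [← hx3 s hs, ← hx3 s' hs'] at h2
      exact absurd h2 hlt.asymm
  · obtain ⟨h1, h2, h3⟩ := h _ (hx1 s hs) _ (hx2 s hs) (hx4 s hs)
    rw [sum_block_apply hP hψ D' h1 h2]
    conv_lhs => rw [hx3 s hs]
    rwa [sum_block_apply hP hφ D (hx1 s hs) (hx2 s hs)]

/-- With one surviving coordinate per block, block `n` can be shrunk to the single index `n`. This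
transfers norm estimates from the unit vectors to the blocks. -/
theorem dominated_sum_block_single (hP : StrictMono P) {G : Finset ℕ} {D : ℕ → ℕ → ℝ}
    {r₀ : ℕ} {g : ℕ →₀ ℝ}
    (h0 : ∀ n ∈ G, ∀ r, r ≠ r₀ → D n r = 0) (h : ∀ n ∈ G, |D n r₀| ≤ |g n|) :
    Dominated (∑ m ∈ G, block P m (D m)) g := by
  have hex := fun s => exists_of_mem_support_sum_block (P := P) (φ := id) (G := G) (D := D) (s := s)
  choose! x hx1 hx2 hx3 hx4 using hex
  have hr : ∀ s ∈ (∑ m ∈ G, block P m (D m)).support, (x s).2 = r₀ := by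
    intro s hs
    by_contra hne
    exact hx4 s hs (h0 _ (hx1 s hs) _ hne)
  refine ⟨fun s => (x s).1, fun s hs s' hs' hlt => ?_, fun s hs => ?_⟩
  · by_contra hle
    have h1 := hP.monotone (not_lt.1 hle)
    have h2 := hx3 s hs
    have h3 := hx3 s' hs'
    rw [hr s hs] at h2
    rw [hr s' hs'] at h3
    simp only [id] at h1 h2 h3
    omega
  · refine le_trans (le_of_eq ?_) (h _ (hx1 s hs))
    conv_lhs => rw [hx3 s hs]
    have := sum_block_apply hP strictMono_id D (hx1 s hs) (hx2 s hs)
    simp only [id] at this ⊢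
    rw [this, hr s hs]

variable {p γ : ℝ}

theorem tirilmanNorm_sum_block_le (hP : StrictMono P) (hp : 1 < p) (hγ0 : 0 < γ)
    (hγ1 : γ < 1) {φ : ℕ → ℕ}
    (hφ : StrictMono φ) {G : Finset ℕ} {D M : ℕ → ℕ → ℝ} (hM : ∀ n r, 0 ≤ M n r)
    (h : ∀ n r, |D n r| ≤ M n r ^ (1 / p)) :
    tirilmanNorm p γ (∑ m ∈ G, block P (φ m) (D m)) ≤
      (∑ n ∈ G, ∑ r ∈ Finset.range (P (φ n + 1) - P (φ n)), M n r) ^ (1 / p) := by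
  have hp0 : 0 < p := by linarith
  refine (tirilmanNorm_le_powNorm hp hγ0 hγ1 _).trans ?_
  refine Real.rpow_le_rpow (powNorm_nonneg p _) ?_ (one_div_nonneg.2 hp0.le)
  set a := ∑ m ∈ G, block P (φ m) (D m) with ha
  set J : Finset (Σ _ : ℕ, ℕ) := G.sigma fun n => Finset.range (P (φ n + 1) - P (φ n)) with hJ
  have hJ' : ∀ x ∈ J, x.1 ∈ G ∧ P (φ x.1) + x.2 < P (φ x.1 + 1) := by
    intro x hx
    obtain ⟨h1, h2⟩ := Finset.mem_sigma.1 hx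
    rw [Finset.mem_range] at h2
    exact ⟨h1, by omega⟩
  have hinj : Set.InjOn (fun x : Σ _ : ℕ, ℕ => P (φ x.1) + x.2) (J : Set (Σ _ : ℕ, ℕ)) := by
    rintro ⟨n, r⟩ hx ⟨n', r'⟩ hx' hxx
    have h1 := (hJ' _ hx).2
    have h2 := (hJ' _ hx').2
    simp only at hxx h1 h2
    have h3 : n = n' := hφ.injective (hP.eq_of_mem_block
      (Finset.mem_Ico.2 ⟨Nat.le_add_right _ r, h1⟩)
      (Finset.mem_Ico.2 ⟨by omega, by omega⟩))
    subst h3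
    have h4 : r = r' := by omega
    rw [h4]
  have hsub : a.support ⊆ J.image fun x => P (φ x.1) + x.2 := by
    intro s hs
    obtain ⟨⟨n, r⟩, h1, h2, h3, -⟩ := exists_of_mem_support_sum_block hs
    refine Finset.mem_image.2 ⟨⟨n, r⟩, Finset.mem_sigma.2 ⟨h1, Finset.mem_range.2 ?_⟩, h3.symm⟩
    simp only at h2 ⊢
    omega
  calc powNorm p a ≤ ∑ s ∈ J.image fun x => P (φ x.1) + x.2, |a s| ^ p :=
        Finset.sum_le_sum_of_subset_of_nonneg hsub fun _ _ _ => Real.rpow_nonneg (abs_nonneg _) _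
    _ = ∑ x ∈ J, |a (P (φ x.1) + x.2)| ^ p := Finset.sum_image hinj
    _ ≤ ∑ x ∈ J, M x.1 x.2 := by
        refine Finset.sum_le_sum fun x hx => ?_
        rw [ha, sum_block_apply hP hφ D (hJ' x hx).1 (hJ' x hx).2]
        have h2 := Real.rpow_le_rpow (abs_nonneg _) (h x.1 x.2) hp0.le
        rwa [← Real.rpow_mul (hM _ _), one_div_mul_cancel hp0.ne', Real.rpow_one] at h2
    _ = _ := Finset.sum_sigma _ _ _

end


/-! ### The block sequences -/

/-- Rapidly decreasing weights. -/
def wt (k : ℕ) : ℝ := (1 / 2) ^ k ^ 2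

theorem wt_pos (k : ℕ) : 0 < wt k := pow_pos (by norm_num) _

theorem wt_le_one (k : ℕ) : wt k ≤ 1 := pow_le_one₀ (by norm_num) (by norm_num)

/-- The exponents satisfy (k+1+i)² ≥ k² + k + 1 + i, so the tail is dominated by a geometric series.
-/
theorem sum_wt_le (k b : ℕ) : ∑ j ∈ Finset.Ico (k + 1) b, wt j ≤ (1 / 2) ^ k * wt k := by
  have h1 : ∀ n, ∑ i ∈ Finset.range n, ((1 : ℝ) / 2) ^ i = 2 - 2 * (1 / 2) ^ n := by
    intro n
    induction n with
    | zero => norm_num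
    | succ n ih => rw [Finset.sum_range_succ, ih, pow_succ]; ring
  rw [Finset.sum_Ico_eq_sum_range]
  have h2 : ∀ i, wt (k + 1 + i) ≤ (1 / 2) ^ k * wt k * (1 / 2) * (1 / 2) ^ i := by
    intro i
    rw [wt, wt, ← pow_add, ← pow_succ, ← pow_add]
    refine pow_le_pow_of_le_one (by norm_num) (by norm_num) ?_
    nlinarith
  refine (Finset.sum_le_sum fun i _ => h2 i).trans ?_
  rw [← Finset.mul_sum, h1]
  have h3 : 0 < (1 / 2 : ℝ) ^ k * wt k := mul_pos (by positivity) (wt_pos k)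
  have h4 : 0 < (1 / 2 : ℝ) ^ (b - (k + 1)) := by positivity
  nlinarith

/-- The positions `s k` at which the parts of length `2 ^ K k` of the profile vectors start, and the
starting positions `P n` of the blocks. -/
structure Layout (p : ℝ) where
  K : ℕ → ℕ
  s : ℕ → ℕ
  P : ℕ → ℕ
  strictMono_K : StrictMono K
  s_zero : s 0 = 0
  s_succ : ∀ k, s (k + 1) = s k + 2 ^ K k
  P_succ : ∀ n, P (n + 1) = P n + s (n + 1)
  growth : ∀ k, (s k : ℝ) ^ p * 2 ^ k / wt k ≤ ((K k : ℝ) + 2) / 2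

theorem nonempty_layout (p : ℝ) : Nonempty (Layout p) := by
  have hex : ∀ (k K₀ s : ℕ), ∃ K, K₀ < K ∧ (s : ℝ) ^ p * 2 ^ k / wt k ≤ ((K : ℝ) + 2) / 2 := by
    intro k K₀ s
    obtain ⟨N, hN⟩ := exists_nat_ge (2 * ((s : ℝ) ^ p * 2 ^ k / wt k))
    refine ⟨max N (K₀ + 1), (Nat.lt_succ_self _).trans_le (le_max_right _ _), ?_⟩
    have : (N : ℝ) ≤ (max N (K₀ + 1) : ℕ) := by exact_mod_cast le_max_left _ _
    linarith
  choose g hg1 hg2 using hex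
  -- The state is the pair (K k, s k). The next position is determined by it, and the next exponent
  -- is chosen only afterwards, large compared with that position.
  let seq : ℕ → ℕ × ℕ := Nat.rec (g 0 0 0, 0)
    fun k x => (g (k + 1) x.1 (x.2 + 2 ^ x.1), x.2 + 2 ^ x.1)
  refine ⟨⟨fun k => (seq k).1, fun k => (seq k).2,
    fun n => ∑ m ∈ Finset.range n, (seq (m + 1)).2, strictMono_nat_of_lt_succ fun k => hg1 _ _ _,
    rfl, fun k => rfl, fun n => Finset.sum_range_succ _ _, fun k => ?_⟩⟩
  cases k with
  | zero => exact hg2 0 0 0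
  | succ k => exact hg2 _ _ _

namespace Layout

variable {p : ℝ} (L : Layout p)

theorem strictMono_s : StrictMono L.s :=
  strictMono_nat_of_lt_succ fun k => by
    rw [L.s_succ]
    exact Nat.lt_add_of_pos_right (by positivity)

theorem strictMono_P : StrictMono L.P :=
  strictMono_nat_of_lt_succ fun n => by
    rw [L.P_succ]
    exact Nat.lt_add_of_pos_right ((Nat.zero_le _).trans_lt (L.strictMono_s n.lt_succ_self))

/-- The `p`-th powers of the coordinates of the profile vector whose parts are indexed by `A`. -/
def profilePow (A : Set ℕ) (r : ℕ) : ℝ :=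
  -- At most one term is non-zero, and since j ≤ s j the range reaches the part that contains r.
  ∑ j ∈ Finset.range (r + 1),
    if r ∈ Finset.Ico (L.s j) (L.s (j + 1)) then A.indicator (fun j => wt j / 2 ^ L.K j) j else 0

/-- The profile vector whose parts are indexed by `A`. -/
def profile (A : Set ℕ) (r : ℕ) : ℝ := L.profilePow A r ^ (1 / p)

theorem profilePow_eq (A : Set ℕ) {k r : ℕ} (hr : r ∈ Finset.Ico (L.s k) (L.s (k + 1))) :
    L.profilePow A r = A.indicator (fun j => wt j / 2 ^ L.K j) k := by
  have hk : k ∈ Finset.range (r + 1) :=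
    Finset.mem_range.2 (Nat.lt_succ_of_le
      ((L.strictMono_s.le_apply (x := k)).trans (Finset.mem_Ico.1 hr).1))
  rw [profilePow, Finset.sum_eq_single_of_mem k hk, if_pos hr]
  exact fun j _ hjk => if_neg fun h => hjk (L.strictMono_s.eq_of_mem_block h hr)

theorem indicator_nonneg (A : Set ℕ) (k : ℕ) :
    0 ≤ A.indicator (fun j => wt j / 2 ^ L.K j) k :=
  Set.indicator_nonneg (fun j _ => div_nonneg (wt_pos j).le (by positivity)) k

theorem indicator_le (A : Set ℕ) (k : ℕ) :
    A.indicator (fun j => wt j / 2 ^ L.K j) k ≤ wt k / 2 ^ L.K k :=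
  Set.indicator_apply_le' (fun _ => le_rfl) fun _ => div_nonneg (wt_pos k).le (by positivity)

theorem profilePow_nonneg (A : Set ℕ) (r : ℕ) : 0 ≤ L.profilePow A r :=
  Finset.sum_nonneg fun j _ => by
    split_ifs
    · exact L.indicator_nonneg A j
    · exact le_rfl

theorem profile_nonneg (A : Set ℕ) (r : ℕ) : 0 ≤ L.profile A r :=
  Real.rpow_nonneg (L.profilePow_nonneg A r) _

/-- Part j consists of 2^(K j) coordinates whose p-th powers are at most wt j / 2^(K j), so its mass
is at most wt j. -/
theorem sum_profilePow_le (A : Set ℕ) {a b : ℕ} (hab : a ≤ b) :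
    ∑ r ∈ Finset.Ico (L.s a) (L.s b), L.profilePow A r ≤ ∑ j ∈ Finset.Ico a b, wt j := by
  induction b, hab using Nat.le_induction with
  | base => simp
  | succ b hab ih =>
    rw [← Finset.sum_Ico_consecutive _ (L.strictMono_s.monotone hab)
      (L.strictMono_s.monotone b.le_succ), Finset.sum_Ico_succ_top hab]
    refine add_le_add ih ?_
    rw [Finset.sum_congr rfl fun r hr => L.profilePow_eq A hr, Finset.sum_const, Nat.card_Ico,
      L.s_succ, Nat.add_sub_cancel_left, nsmul_eq_mul]
    refine (mul_le_mul_of_nonneg_left (L.indicator_le A b) (Nat.cast_nonneg _)).trans_eq ?_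
    push_cast
    field_simp

theorem sum_profilePow_range_le (A : Set ℕ) (k b : ℕ) :
    ∑ r ∈ Finset.range (L.s b), (if L.s (k + 1) ≤ r then L.profilePow A r else 0) ≤
      (1 / 2) ^ k * wt k := by
  have h0 : 0 ≤ (1 / 2 : ℝ) ^ k * wt k := mul_nonneg (by positivity) (wt_pos k).le
  rw [← Finset.sum_filter]
  have hfil : (Finset.range (L.s b)).filter (fun r => L.s (k + 1) ≤ r) =
      Finset.Ico (L.s (k + 1)) (L.s b) := by
    ext r
    simp [and_comm]
  rw [hfil]
  rcases le_total (k + 1) b with hkb | hkb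
  · exact (L.sum_profilePow_le A hkb).trans (sum_wt_le k b)
  · rw [Finset.Ico_eq_empty_of_le (L.strictMono_s.monotone hkb), Finset.sum_empty]
    exact h0

theorem profilePow_le_one (A : Set ℕ) (r : ℕ) : L.profilePow A r ≤ 1 := by
  have hex : ∃ k, r ∈ Finset.Ico (L.s k) (L.s (k + 1)) := by
    have h : ∃ n, r < L.s n := ⟨r + 1, (Nat.lt_succ_self r).trans_le L.strictMono_s.le_apply⟩
    classical
    have h1 := Nat.find_spec h
    have h0 : Nat.find h ≠ 0 := by
      intro h0
      rw [h0, L.s_zero] at h1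
      omega
    refine ⟨Nat.find h - 1, Finset.mem_Ico.2 ⟨not_lt.1 (Nat.find_min h (by omega)), ?_⟩⟩
    rwa [Nat.sub_add_cancel (by omega)]
  obtain ⟨k, hk⟩ := hex
  rw [L.profilePow_eq A hk]
  refine (L.indicator_le A k).trans ?_
  rw [div_le_one (by positivity)]
  exact (wt_le_one k).trans (one_le_pow₀ one_le_two)

/-- The blocks formed with the truncations of the profile vector. -/
def blockVec (A : Set ℕ) (n : ℕ) : ℕ →₀ ℝ := block L.P n (L.profile A)

theorem smul_blockVec (A : Set ℕ) (c : ℝ) (n : ℕ) :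
    c • L.blockVec A n = block L.P n fun r => c * L.profile A r := block_smul _ _ _ _

theorem profile_zero_pos {A : Set ℕ} (hA : 0 ∈ A) : 0 < L.profile A 0 := by
  have h : (0 : ℕ) ∈ Finset.Ico (L.s 0) (L.s (0 + 1)) :=
    Finset.mem_Ico.2 ⟨L.s_zero.le, (Nat.zero_le _).trans_lt (L.strictMono_s Nat.zero_lt_one)⟩
  rw [profile, L.profilePow_eq A h, Set.indicator_of_mem hA]
  exact Real.rpow_pos_of_pos (div_pos (wt_pos 0) (by positivity)) _

theorem blockVec_apply_start (A : Set ℕ) (m n : ℕ) :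
    L.blockVec A m (L.P n) = if n = m then L.profile A 0 else 0 := by
  have hmem : L.P n ∈ Finset.Ico (L.P n) (L.P (n + 1)) :=
    Finset.mem_Ico.2 ⟨le_rfl, L.strictMono_P n.lt_succ_self⟩
  rw [blockVec, block_apply]
  rcases eq_or_ne n m with rfl | hnm
  · rw [if_pos hmem, if_pos rfl, Nat.sub_self]
  · rw [if_neg fun h => hnm (L.strictMono_P.eq_of_mem_block hmem h), if_neg hnm]

theorem add_lt_P_iff {n r : ℕ} : L.P n + r < L.P (n + 1) ↔ r < L.s (n + 1) := by
  rw [L.P_succ]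
  omega

variable {γ : ℝ}

theorem tirilmanNorm_sum_blockVec_mono (hp : 1 < p) (hγ0 : 0 < γ) (hγ1 : γ < 1) (A : Set ℕ)
    {φ ψ : ℕ → ℕ} (hφ : StrictMono φ) (hψ : StrictMono ψ) (hφψ : ∀ n, φ n ≤ ψ n)
    {G G' : Finset ℕ} (b : ℕ → ℝ) (hG : ∀ n ∈ G, b n ≠ 0 → n ∈ G') :
    tirilmanNorm p γ (∑ n ∈ G, b n • L.blockVec A (φ n)) ≤
      tirilmanNorm p γ (∑ n ∈ G', b n • L.blockVec A (ψ n)) := by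
  simp only [smul_blockVec]
  refine tirilmanNorm_le_of_dominated hp hγ0 hγ1
    (dominated_sum_block L.strictMono_P hφ hψ fun n hn r hr hne =>
      ⟨hG n hn (left_ne_zero_of_mul hne), ?_, le_rfl⟩)
  rw [L.add_lt_P_iff] at hr ⊢
  exact hr.trans_le (L.strictMono_s.monotone (Nat.succ_le_succ (hφψ n)))

/-- Passing to later, hence longer, blocks changes the norms by a small amount only. -/
theorem tirilmanNorm_sum_blockVec_comp_le (hp : 1 < p) (hγ0 : 0 < γ) (hγ1 : γ < 1) (A : Set ℕ)
    {φ : ℕ → ℕ} (hφ : StrictMono φ) (G : Finset ℕ) (b : ℕ → ℝ) :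
    tirilmanNorm p γ (∑ n ∈ G, b n • L.blockVec A (φ n)) ≤
      tirilmanNorm p γ (∑ n ∈ G, b n • L.blockVec A n) +
        ∑ n ∈ G, |b n| * ((1 / 2 : ℝ) ^ (1 / p)) ^ n := by
  have hp0 : 0 < p := by linarith
  have hgood := goodNorm_tirilmanNorm hp hγ0 hγ1
  -- As n ≤ φ n, the first s (n + 1) coordinates of block φ n are a copy of block n, and these
  -- copies together form a spread of the original sum. What remains is a tail of the profile, whose
  -- mass is at most 2^(-n) wt n.
  have hsplit : ∑ n ∈ G, b n • L.blockVec A (φ n) =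
      ∑ n ∈ G, block L.P (φ n) (fun r => if r < L.s (n + 1) then b n * L.profile A r else 0) +
      ∑ n ∈ G, b n • block L.P (φ n)
        (fun r => if L.s (n + 1) ≤ r then L.profile A r else 0) := by
    rw [← Finset.sum_add_distrib]
    refine Finset.sum_congr rfl fun n _ => ?_
    rw [block_smul, smul_blockVec, ← block_add]
    congr 1
    ext r
    rcases lt_or_ge r (L.s (n + 1)) with h | h
    · rw [if_pos h, if_neg (not_le.2 h), mul_zero, add_zero]
    · rw [if_neg (not_lt.2 h), if_pos h, zero_add]
  rw [hsplit]
  refine (hgood.add_le _ _).trans (add_le_add ?_ ?_)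
  · simp only [smul_blockVec]
    refine tirilmanNorm_le_of_dominated hp hγ0 hγ1
      (dominated_sum_block L.strictMono_P hφ strictMono_id fun n hn r hr hne => ?_)
    have h : r < L.s (n + 1) := by
      by_contra h
      exact hne (if_neg h)
    refine ⟨hn, L.add_lt_P_iff.2 h, ?_⟩
    rw [if_pos h]
  · refine (tirilmanNorm_sum_le hp hγ0 hγ1 _ _).trans (Finset.sum_le_sum fun n _ => ?_)
    rw [hgood.smul]
    refine mul_le_mul_of_nonneg_left ?_ (abs_nonneg _)
    have h := tirilmanNorm_sum_block_le L.strictMono_P hp hγ0 hγ1 strictMono_id (G := {φ n})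
      (D := fun _ r => if L.s (n + 1) ≤ r then L.profile A r else 0)
      (M := fun _ r => if L.s (n + 1) ≤ r then L.profilePow A r else 0)
      (fun _ r => by
        split_ifs
        · exact L.profilePow_nonneg A r
        · exact le_rfl)
      (fun _ r => by
        split_ifs
        · rw [abs_of_nonneg (L.profile_nonneg A r), profile]
        · rw [abs_zero]
          exact Real.rpow_nonneg le_rfl _)
    rw [Finset.sum_singleton, Finset.sum_singleton] at h
    refine h.trans ?_
    rw [← Real.rpow_natCast, ← Real.rpow_mul (by norm_num), mul_comm, Real.rpow_mul (by norm_num),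
      Real.rpow_natCast]
    simp only [id, L.P_succ, Nat.add_sub_cancel_left]
    have h2 := L.sum_profilePow_range_le A n (φ n + 1)
    refine Real.rpow_le_rpow (Finset.sum_nonneg fun r _ => ?_) (h2.trans ?_)
      (one_div_nonneg.2 hp0.le)
    · split_ifs
      · exact L.profilePow_nonneg A r
      · exact le_rfl
    · exact mul_le_of_le_one_right (by positivity) (wt_le_one n)

end Layout

theorem exists_sum_Ico_lt_of_summable {f : ℕ → ℝ} (hf : Summable f) {ε : ℝ} (hε : 0 < ε) :
    ∃ N, ∀ m n, N ≤ m → ∑ i ∈ Finset.Ico m n, f i < ε := by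
  obtain ⟨s, hs⟩ := summable_iff_vanishing_norm.1 hf ε hε
  refine ⟨s.sup id + 1, fun m n hm => (le_abs_self _).trans_lt (hs _ ?_)⟩
  refine Finset.disjoint_left.2 fun i hi his => ?_
  have h1 := Finset.le_sup (f := id) his
  have h2 := (Finset.mem_Ico.1 hi).1
  simp only [id] at h1
  omega

theorem half_rpow_lt_one {p : ℝ} (hp : 1 < p) : (1 / 2 : ℝ) ^ (1 / p) < 1 :=
  Real.rpow_lt_one (by norm_num) (by norm_num) (one_div_pos.2 (by linarith))

/-! ### Subsymmetry of the block sequences -/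

namespace Layout

variable {p : Set.Ioi (1 : ℝ)} (γ : Set.Ioo (0 : ℝ) 1) (L : Layout (p : ℝ))

theorem isBlockBasis {A : Set ℕ} (hA : 0 ∈ A) :
    IsBlockBasis (tirilmanBasis p γ) fun n => tirilmanEmb p γ (L.blockVec A n) := by
  refine isBlockBasis_of_support (tirilmanEmb p γ) L.strictMono_P
    (fun n => support_block_subset _ _ _) fun n h => ?_
  have h1 := abs_le_tirilmanNorm p.2 γ.2.1 γ.2.2 (L.blockVec A n) (L.P n)
  rw [← norm_tirilmanEmb p γ, h, norm_zero, L.blockVec_apply_start, if_pos rfl] at h1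
  exact absurd (abs_nonpos_iff.1 h1) (L.profile_zero_pos hA).ne'

/-- The coordinate at the start of each block, non-zero because 0 ∈ A, provides the biorthogonal
functionals. By domination, the coordinate projections have norm at most one. -/
theorem isUnconditionalBasicSequence {A : Set ℕ} (hA : 0 ∈ A) :
    IsUnconditionalBasicSequence fun n => tirilmanEmb p γ (L.blockVec A n) := by
  choose f hf using exists_coordinate p γ
  have hpos := L.profile_zero_pos hA
  have hortho : ∀ i j, ((L.profile A 0)⁻¹ • f (L.P i)) (tirilmanEmb p γ (L.blockVec A j)) =
      if i = j then 1 else 0 := by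
    intro i j
    rw [smul_apply, hf, L.blockVec_apply_start]
    split_ifs
    · exact inv_mul_cancel₀ hpos.ne'
    · simp
  refine isUnconditionalBasicSequence_of_biorthogonal
    (fun i => (L.profile A 0)⁻¹ • f (L.P i)) hortho zero_le_one fun G z hz => ?_
  obtain ⟨b, rfl⟩ := Finsupp.mem_span_range_iff_exists_finsupp.1 hz
  have hb : ∀ i, ((L.profile A 0)⁻¹ • f (L.P i))
      (b.sum fun j c => c • tirilmanEmb p γ (L.blockVec A j)) = b i := by
    intro i
    rw [Finsupp.sum, map_sum]
    simp only [map_smul, hortho]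
    simpa using Eq.symm
  have h1 : ∑ i ∈ G, ((L.profile A 0)⁻¹ • f (L.P i))
      (b.sum fun j c => c • tirilmanEmb p γ (L.blockVec A j)) • tirilmanEmb p γ (L.blockVec A i) =
      tirilmanEmb p γ (∑ i ∈ G, b i • L.blockVec A i) := by
    rw [map_sum]
    refine Finset.sum_congr rfl fun i _ => ?_
    rw [hb, map_smul]
  have h2 : (b.sum fun j c => c • tirilmanEmb p γ (L.blockVec A j)) =
      tirilmanEmb p γ (∑ i ∈ b.support, b i • L.blockVec A i) := by
    rw [map_sum, Finsupp.sum]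
    exact Finset.sum_congr rfl fun i _ => (map_smul _ _ _).symm
  rw [h1, h2, one_mul, norm_tirilmanEmb, norm_tirilmanEmb]
  exact L.tirilmanNorm_sum_blockVec_mono p.2 γ.2.1 γ.2.2 A strictMono_id strictMono_id
    (fun _ => le_rfl) b fun n _ hn => Finsupp.mem_support_iff.2 hn

theorem seqEquivalent_comp {A : Set ℕ} (hA : 0 ∈ A) {φ : ℕ → ℕ} (hφ : StrictMono φ) :
    SeqEquivalent (fun n => tirilmanEmb p γ (L.blockVec A n))
      (fun n => tirilmanEmb p γ (L.blockVec A (φ n))) := by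
  intro b
  rw [seriesConverges_tirilmanEmb_iff, seriesConverges_tirilmanEmb_iff]
  constructor
  · intro h ε hε
    have hpos := L.profile_zero_pos hA
    obtain ⟨M₀, hM₀⟩ := h (ε / 2) (half_pos hε)
    obtain ⟨M₁, hM₁⟩ := h (L.profile A 0) hpos
    -- The single terms of the series tend to zero and their starting coordinates are b n times a
    -- fixed positive number. Bounded coefficients make the error terms summable.
    have hb : ∀ n, M₁ ≤ n → |b n| ≤ 1 := by
      intro n hn
      have h1 := hM₁ n (n + 1) hn n.le_succ
      rw [Nat.Ico_succ_singleton, Finset.sum_singleton] at h1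
      have h2 := (abs_le_tirilmanNorm p.2 γ.2.1 γ.2.2 (b n • L.blockVec A n) (L.P n)).trans h1.le
      rw [Finsupp.smul_apply, smul_eq_mul, abs_mul, L.blockVec_apply_start, if_pos rfl,
        abs_of_pos hpos] at h2
      exact le_of_mul_le_mul_right (by simpa using h2) hpos
    obtain ⟨M₂, hM₂⟩ := exists_sum_Ico_lt_of_summable (summable_geometric_of_lt_one
      (by positivity) (half_rpow_lt_one p.2)) (half_pos hε)
    refine ⟨max M₀ (max M₁ M₂), fun m n hm hmn => ?_⟩
    obtain ⟨h0, h1, h2⟩ : M₀ ≤ m ∧ M₁ ≤ m ∧ M₂ ≤ m := by omega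
    refine (L.tirilmanNorm_sum_blockVec_comp_le p.2 γ.2.1 γ.2.2 A hφ _ b).trans_lt ?_
    have h3 := hM₀ m n h0 hmn
    have h4 := hM₂ m n h2
    have h5 : ∑ i ∈ Finset.Ico m n, |b i| * ((1 / 2 : ℝ) ^ (1 / (p : ℝ))) ^ i ≤
        ∑ i ∈ Finset.Ico m n, ((1 / 2 : ℝ) ^ (1 / (p : ℝ))) ^ i :=
      Finset.sum_le_sum fun i hi => mul_le_of_le_one_left (by positivity)
        (hb i (h1.trans (Finset.mem_Ico.1 hi).1))
    linarith
  · intro h ε hε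
    obtain ⟨M, hM⟩ := h ε hε
    refine ⟨M, fun m n hm hmn => (L.tirilmanNorm_sum_blockVec_mono p.2 γ.2.1 γ.2.2 A strictMono_id
      hφ (fun n => hφ.le_apply) b fun _ hn _ => hn).trans_lt (hM m n hm hmn)⟩

theorem isSubsymmetric {A : Set ℕ} (hA : 0 ∈ A) :
    IsSubsymmetric fun n => tirilmanEmb p γ (L.blockVec A n) :=
  ⟨L.isUnconditionalBasicSequence γ hA, fun _ hφ => L.seqEquivalent_comp γ hA hφ⟩

end Layout


/-! ### Non-equivalence -/

theorem dyadic_disjoint {K K' n : ℕ} (h : n ∈ dyadic K) (h' : n ∈ dyadic K') : K = K' :=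
  (pow_right_strictMono₀ one_lt_two).eq_of_mem_block h h'

namespace Layout

variable {p γ : ℝ} (L : Layout p)

/-- The sum of the ruler sequence over the dyadic interval of order `K k`. -/
def rulerSum (k : ℕ) : ℕ := ∑ n ∈ dyadic (L.K k), ruler n

theorem rulerSum_pos (k : ℕ) : 0 < L.rulerSum k := by
  refine Finset.sum_pos (fun n _ => ruler_pos n) ⟨2 ^ L.K k, Finset.mem_Ico.2 ⟨le_rfl, ?_⟩⟩
  exact Nat.pow_lt_pow_right one_lt_two (Nat.lt_succ_self _)

/-- The `p`-th powers of the coefficients of the vector that detects the `k`-th part of the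
profile vector. -/
def testPow (k n : ℕ) : ℝ :=
  if n ∈ dyadic (L.K k) then ruler n / (wt k * L.rulerSum k) else 0

/-- The coefficients of the vector that detects the `k`-th part of the profile vector. -/
def test (k n : ℕ) : ℝ := L.testPow k n ^ (1 / p)

theorem scale_pos (k : ℕ) : 0 < wt k * L.rulerSum k :=
  mul_pos (wt_pos k) (Nat.cast_pos.2 (L.rulerSum_pos k))

theorem testPow_nonneg (k n : ℕ) : 0 ≤ L.testPow k n := by
  rw [testPow]
  split_ifs
  · exact div_nonneg (Nat.cast_nonneg _) (L.scale_pos k).le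
  · exact le_rfl

theorem test_nonneg (k n : ℕ) : 0 ≤ L.test k n := Real.rpow_nonneg (L.testPow_nonneg k n) _

theorem test_eq_zero (hp : 1 < p) {k n : ℕ} (hn : n ∉ dyadic (L.K k)) : L.test k n = 0 := by
  rw [test, testPow, if_neg hn, Real.zero_rpow (one_div_ne_zero (by linarith))]

theorem sum_testPow_le (k : ℕ) (G : Finset ℕ) : ∑ n ∈ G, L.testPow k n ≤ 1 / wt k := by
  have h1 : ∑ n ∈ dyadic (L.K k), L.testPow k n = 1 / wt k := by
    have h2 : ∀ n ∈ dyadic (L.K k), L.testPow k n = ruler n / (wt k * L.rulerSum k) :=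
      fun n hn => if_pos hn
    have h3 : ((∑ n ∈ dyadic (L.K k), (ruler n : ℝ)) : ℝ) = L.rulerSum k := by
      rw [rulerSum]
      push_cast
      rfl
    have h4 : (L.rulerSum k : ℝ) ≠ 0 := Nat.cast_ne_zero.2 (L.rulerSum_pos k).ne'
    rw [Finset.sum_congr rfl h2, ← Finset.sum_div, h3]
    have := (wt_pos k).ne'
    field_simp
  calc ∑ n ∈ G, L.testPow k n ≤ ∑ n ∈ G ∪ dyadic (L.K k), L.testPow k n :=
        Finset.sum_le_sum_of_subset_of_nonneg Finset.subset_union_left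
          fun n _ _ => L.testPow_nonneg k n
    _ = ∑ n ∈ dyadic (L.K k), L.testPow k n :=
        (Finset.sum_subset Finset.subset_union_right fun n _ hn => if_neg hn).symm
    _ = 1 / wt k := h1

/-- The test vectors have large norms if the `k`-th part of the profile vector is present. -/
theorem le_tirilmanNorm_test (hp : 1 < p) (hγ0 : 0 < γ) (hγ1 : γ < 1) {A : Set ℕ} {k : ℕ}
    (hk : k ∈ A) :
    γ ^ 2 ≤ tirilmanNorm p γ (∑ n ∈ dyadic (L.K k), L.test k n • L.blockVec A n) := by
  have hp0 : 0 < p := by linarith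
  set a := ∑ n ∈ dyadic (L.K k), L.test k n • L.blockVec A n with ha
  have hS : (0 : ℝ) < L.rulerSum k := Nat.cast_pos.2 (L.rulerSum_pos k)
  -- This ensures that block n is long enough to contain part k entirely, since it holds the parts
  -- 0, …, n.
  have hkn : ∀ n ∈ dyadic (L.K k), k ≤ n := fun n hn =>
    ((L.strictMono_K.le_apply (x := k)).trans (Nat.lt_two_pow_self).le).trans
      (Finset.mem_Ico.1 hn).1
  have hval : ∀ n ∈ dyadic (L.K k), ∀ i < 2 ^ L.K k,
      L.P n + (L.s k + i) < L.P (n + 1) ∧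
      a (L.P n + (L.s k + i)) = (ruler n / 2 ^ L.K k / L.rulerSum k : ℝ) ^ (1 / p) := by
    intro n hn i hi
    have hr : L.s k + i ∈ Finset.Ico (L.s k) (L.s (k + 1)) := by
      rw [L.s_succ, Finset.mem_Ico]
      omega
    have hlt : L.P n + (L.s k + i) < L.P (n + 1) :=
      L.add_lt_P_iff.2 ((Finset.mem_Ico.1 hr).2.trans_le
        (L.strictMono_s.monotone (Nat.succ_le_succ (hkn n hn))))
    refine ⟨hlt, ?_⟩
    simp only [ha, smul_blockVec]
    have h1 := sum_block_apply L.strictMono_P strictMono_id (G := dyadic (L.K k))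
      (fun n r => L.test k n * L.profile A r) hn hlt
    simp only [id] at h1
    rw [h1, test, testPow, if_pos hn, profile, L.profilePow_eq A hr, Set.indicator_of_mem hk,
      ← Real.mul_rpow (div_nonneg (Nat.cast_nonneg _) (L.scale_pos k).le)
        (div_nonneg (wt_pos k).le (by positivity))]
    congr 1
    have := (wt_pos k).ne'
    field_simp
  have hlen : ∀ n ∈ dyadic (L.K k), 2 ^ L.K k / ruler n * ruler n = 2 ^ L.K k := fun n hn =>
    Nat.div_mul_cancel (ruler_dvd_of_mem_dyadic hn)
  -- Part k of block n is cut into ρ(n) intervals of equal length 2^(K k) / ρ(n), indexed by (n, t).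
  -- The lexicographic order makes all these intervals successive.
  let J : Finset (Σₗ _ : ℕ, ℕ) :=
    ((dyadic (L.K k)).sigma fun n => Finset.range (ruler n)).map toLex.toEmbedding
  have hJ : ∀ x ∈ J, ∃ n ∈ dyadic (L.K k), ∃ t < ruler n, x = toLex ⟨n, t⟩ := by
    intro x hx
    obtain ⟨⟨n, t⟩, h1, rfl⟩ := Finset.mem_map.1 hx
    obtain ⟨h2, h3⟩ := Finset.mem_sigma.1 h1
    exact ⟨n, h2, t, Finset.mem_range.1 h3, rfl⟩
  let len : ℕ → ℕ := fun n => 2 ^ L.K k / ruler n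
  let st : (Σₗ _ : ℕ, ℕ) → ℕ := fun x =>
    L.P (ofLex x).1 + (L.s k + (ofLex x).2 * len (ofLex x).1)
  have hin : ∀ n ∈ dyadic (L.K k), ∀ t < ruler n, ∀ i < len n, t * len n + i < 2 ^ L.K k := by
    intro n hn t ht i hi
    rw [← hlen n hn, mul_comm (2 ^ L.K k / ruler n)]
    calc t * len n + i < t * len n + len n := by omega
      _ = (t + 1) * len n := by ring
      _ ≤ ruler n * len n := Nat.mul_le_mul_right _ ht
  have hcard : J.card = L.rulerSum k := by
    rw [Finset.card_map, Finset.card_sigma]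
    simp [rulerSum]
  have key := card_rpow_le_tirilmanNorm hp hγ0 hγ1 J
    (fun x => Finset.Ico (st x) (st x + len (ofLex x).1)) ?_ a
    -- One factor γ comes from the flat estimate on each interval, the other from combining the
    -- intervals.
    (δ := γ * (1 / L.rulerSum k : ℝ) ^ (1 / p)) ?_
  · rw [hcard, mul_assoc, mul_assoc, ← Real.mul_rpow (by positivity) hS.le,
      one_div_mul_cancel hS.ne', Real.one_rpow, mul_one, ← sq] at key
    exact key
  · intro x hx y hy hxy l hl m hm
    obtain ⟨n, hn, t, ht, rfl⟩ := hJ x hx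
    obtain ⟨n', hn', t', ht', rfl⟩ := hJ y hy
    simp only [st, ofLex_toLex, Finset.mem_Ico] at hl hm
    have hlex : n < n' ∨ n = n' ∧ t < t' := by simpa using! Sigma.Lex.lt_def.1 hxy
    rcases hlex with h | ⟨h, h'⟩
    · have h1 := hin n hn t ht (l - (L.P n + (L.s k + t * len n))) (by omega)
      have h2 := (hval n hn _ h1).1
      have h3 := L.strictMono_P.monotone (Nat.succ_le_of_lt h)
      simp only [Nat.succ_eq_add_one] at h3
      omega
    · obtain rfl : n = n' := h
      have h1 : (t + 1) * len n ≤ t' * len n := Nat.mul_le_mul_right _ h'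
      have h2 : (t + 1) * len n = t * len n + len n := by ring
      omega
  · intro x hx
    obtain ⟨n, hn, t, ht, rfl⟩ := hJ x hx
    simp only [st, ofLex_toLex]
    set E := Finset.Ico (L.P n + (L.s k + t * len n)) (L.P n + (L.s k + t * len n) + len n) with hE
    have h1 := flat_le_tirilmanNorm hp hγ0 hγ1 E (restrictTo E a)
      (δ := (ruler n / 2 ^ L.K k / L.rulerSum k : ℝ) ^ (1 / p)) fun l hl => by
        rw [restrictTo_apply, if_pos hl]
        obtain ⟨h2, h3⟩ := Finset.mem_Ico.1 hl
        have h4 := hin n hn t ht (l - (L.P n + (L.s k + t * len n))) (by omega)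
        have h5 := (hval n hn _ h4).2
        rw [show L.P n + (L.s k + (t * len n + (l - (L.P n + (L.s k + t * len n))))) = l by
          omega] at h5
        rw [h5]
        exact le_abs_self _
    refine le_trans (le_of_eq ?_) h1
    rw [hE, Nat.card_Ico, Nat.add_sub_cancel_left, mul_assoc,
      ← Real.mul_rpow (by positivity) (Nat.cast_nonneg _)]
    congr 2
    have h2 : (len n : ℝ) * ruler n = 2 ^ L.K k := by exact_mod_cast hlen n hn
    rw [← h2]
    have h3 : (ruler n : ℝ) ≠ 0 := Nat.cast_ne_zero.2 (ruler_pos n).ne'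
    have h4 : (len n : ℝ) ≠ 0 := by
      rintro h
      rw [h, zero_mul] at h2
      exact (pow_ne_zero _ two_ne_zero) h2.symm
    field_simp

/-- The test vectors have small norms in the span of the unit vectors. -/
theorem tirilmanNorm_test_le (hp : 1 < p) (hγ0 : 0 < γ) (hγ1 : γ < 1)
    (hγ : γ * (2 * p.conjExponent) ≤ 1) (k : ℕ) {g : ℕ →₀ ℝ} (hg : ∀ n, g n = L.test k n) :
    tirilmanNorm p γ g ≤ (2 ^ L.K k / (wt k * L.rulerSum k)) ^ (1 / p) := by
  have hp0 : 0 < p := by linarith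
  have hc := L.scale_pos k
  set c := wt k * L.rulerSum k with hcdef
  have hgood := goodNorm_tirilmanNorm hp hγ0 hγ1
  have h1 : tirilmanNorm p γ (c ^ (1 / p) • g) ≤ ((2 : ℝ) ^ L.K k) ^ (1 / p) := by
    refine tirilmanNorm_le_of_le_ruler hp hγ0 hγ1 hγ
      (fun n hn => not_dvd_of_mem_dyadic (K := L.K k) hn) (fun n hn => ?_) fun n => ?_
    · by_contra h
      refine Finsupp.mem_support_iff.1 hn ?_
      rw [Finsupp.smul_apply, hg, L.test_eq_zero hp h, smul_zero]
    · rw [Finsupp.smul_apply, hg, smul_eq_mul,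
        abs_of_nonneg (mul_nonneg (Real.rpow_nonneg hc.le _) (L.test_nonneg k n)), test,
        ← Real.mul_rpow hc.le (L.testPow_nonneg k n)]
      refine Real.rpow_le_rpow (mul_nonneg hc.le (L.testPow_nonneg k n)) ?_
        (one_div_nonneg.2 hp0.le)
      rw [testPow]
      split_ifs
      · rw [mul_div_cancel₀ _ hc.ne']
      · rw [mul_zero]
        exact Nat.cast_nonneg _
  rw [hgood.smul, abs_of_nonneg (Real.rpow_nonneg hc.le _)] at h1
  rw [Real.div_rpow (by positivity) hc.le, le_div_iff₀ (Real.rpow_pos_of_pos hc _), mul_comm]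
  exact h1

/-- The test vectors have small norms if the `k`-th part of the profile vector is absent. -/
theorem tirilmanNorm_sum_test_le (hp : 1 < p) (hγ0 : 0 < γ) (hγ1 : γ < 1)
    (hγ : γ * (2 * p.conjExponent) ≤ 1) {A : Set ℕ} {k : ℕ} (hk : k ∉ A) (G : Finset ℕ) :
    tirilmanNorm p γ (∑ n ∈ G, L.test k n • L.blockVec A n) ≤
      2 * ((1 / 2 : ℝ) ^ (1 / p)) ^ k := by
  have hp0 : 0 < p := by linarith
  have hip : 0 ≤ 1 / p := one_div_nonneg.2 hp0.le
  have hgood := goodNorm_tirilmanNorm hp hγ0 hγ1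
  have hprofile : ∀ r ∈ Finset.Ico (L.s k) (L.s (k + 1)), L.profile A r = 0 := by
    intro r hr
    rw [profile, L.profilePow_eq A hr, Set.indicator_of_notMem hk,
      Real.zero_rpow (one_div_ne_zero hp0.ne')]
  -- Since part k vanishes, only places before and after it remain. The s k earlier places are
  -- treated one at a time, each comparing with the test vector on the unit basis; the later places
  -- are treated together by the upper ℓ_p estimate.
  have hsplit : ∑ n ∈ G, L.test k n • L.blockVec A n =
      ∑ i ∈ Finset.range (L.s k),
        ∑ n ∈ G, block L.P n (fun r => if r = i then L.test k n * L.profile A r else 0) +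
      ∑ n ∈ G, block L.P n
        (fun r => if L.s (k + 1) ≤ r then L.test k n * L.profile A r else 0) := by
    rw [Finset.sum_comm, ← Finset.sum_add_distrib]
    refine Finset.sum_congr rfl fun n _ => ?_
    rw [smul_blockVec, ← block_sum, ← block_add]
    congr 1
    ext r
    rw [Finset.sum_ite_eq]
    have hss : L.s k < L.s (k + 1) := L.strictMono_s k.lt_succ_self
    rcases lt_or_ge r (L.s k) with h | h
    · rw [if_pos (Finset.mem_range.2 h), if_neg (by omega), add_zero]
    · rw [if_neg (by simpa using h), zero_add]
      split_ifs with h'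
      · rfl
      · rw [hprofile r (Finset.mem_Ico.2 ⟨h, not_le.1 h'⟩), mul_zero]
  have hpow : ((1 / 2 : ℝ) ^ (1 / p)) ^ k = ((1 / 2 : ℝ) ^ k) ^ (1 / p) := by
    rw [← Real.rpow_natCast, ← Real.rpow_mul (by norm_num), mul_comm, Real.rpow_mul (by norm_num),
      Real.rpow_natCast]
  rw [hsplit, two_mul, hpow]
  refine (hgood.add_le _ _).trans (add_le_add ?_ ?_)
  · let g : ℕ →₀ ℝ := Finsupp.onFinset (dyadic (L.K k)) (L.test k) fun n hn => by
      by_contra h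
      exact hn (L.test_eq_zero hp h)
    have hS : (0 : ℝ) < L.rulerSum k := Nat.cast_pos.2 (L.rulerSum_pos k)
    have hg := L.tirilmanNorm_test_le hp hγ0 hγ1 hγ k (g := g) fun n => rfl
    have h1 : ∀ i ∈ Finset.range (L.s k), tirilmanNorm p γ
        (∑ n ∈ G, block L.P n (fun r => if r = i then L.test k n * L.profile A r else 0)) ≤
        (2 ^ L.K k / (wt k * L.rulerSum k)) ^ (1 / p) := by
      intro i _
      refine (tirilmanNorm_le_of_dominated hp hγ0 hγ1 (dominated_sum_block_single L.strictMono_P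
        (r₀ := i) (g := g) (fun n _ r hr => if_neg hr) fun n _ => ?_)).trans hg
      rw [if_pos rfl, abs_mul]
      refine mul_le_of_le_one_right (abs_nonneg _) ?_
      rw [abs_of_nonneg (L.profile_nonneg A i)]
      exact Real.rpow_le_one (L.profilePow_nonneg A i) (L.profilePow_le_one A i) hip
    refine ((tirilmanNorm_sum_le hp hγ0 hγ1 _ _).trans (Finset.sum_le_sum h1)).trans ?_
    rw [Finset.sum_const, Finset.card_range, nsmul_eq_mul]
    -- The triangle inequality costs a factor s k. Moved under the p-th root, it is absorbed by the
    -- growth condition on K k together with the logarithmic gain in the ruler sum.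
    have h2 : (L.s k : ℝ) = ((L.s k : ℝ) ^ p) ^ (1 / p) := by
      rw [← Real.rpow_mul (Nat.cast_nonneg _), mul_one_div_cancel hp0.ne', Real.rpow_one]
    have h3 : 0 ≤ 2 ^ L.K k / (wt k * L.rulerSum k) := div_nonneg (by positivity) (L.scale_pos k).le
    have h4 : (0 : ℝ) ≤ (L.s k : ℝ) ^ p := Real.rpow_nonneg (Nat.cast_nonneg _) _
    rw [h2, ← Real.mul_rpow h4 h3]
    refine Real.rpow_le_rpow (mul_nonneg h4 h3) ?_ hip
    have h5 : ((L.K k : ℝ) + 2) * 2 ^ L.K k ≤ 2 * L.rulerSum k := by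
      exact_mod_cast mul_two_pow_le_sum_ruler (L.K k)
    have h6 := L.growth k
    rw [div_le_iff₀ (wt_pos k)] at h6
    rw [mul_div_assoc', div_le_iff₀ (L.scale_pos k), one_div, inv_pow, ← div_eq_inv_mul,
      le_div_iff₀ (by positivity)]
    calc (L.s k : ℝ) ^ p * 2 ^ L.K k * 2 ^ k = (L.s k : ℝ) ^ p * 2 ^ k * 2 ^ L.K k := by ring
      _ ≤ ((L.K k : ℝ) + 2) / 2 * wt k * 2 ^ L.K k := by gcongr
      _ = ((L.K k : ℝ) + 2) * 2 ^ L.K k / 2 * wt k := by ring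
      _ ≤ 2 * L.rulerSum k / 2 * wt k := by
          have := (wt_pos k).le
          gcongr
      _ = wt k * L.rulerSum k := by ring
  · refine (tirilmanNorm_sum_block_le L.strictMono_P hp hγ0 hγ1 strictMono_id (G := G)
      (M := fun n r => L.testPow k n * if L.s (k + 1) ≤ r then L.profilePow A r else 0)
      (fun n r => ?_) fun n r => ?_).trans ?_
    · refine mul_nonneg (L.testPow_nonneg k n) ?_
      split_ifs
      · exact L.profilePow_nonneg A r
      · exact le_rfl
    · split_ifs
      · rw [abs_of_nonneg (mul_nonneg (L.test_nonneg k n) (L.profile_nonneg A r)), test, profile,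
          Real.mul_rpow (L.testPow_nonneg k n) (L.profilePow_nonneg A r)]
      · rw [abs_zero, mul_zero]
        exact Real.rpow_nonneg le_rfl _
    · have hle : ∀ n, ∑ r ∈ Finset.range (L.P (id n + 1) - L.P (id n)),
          (L.testPow k n * if L.s (k + 1) ≤ r then L.profilePow A r else 0) ≤
          L.testPow k n * ((1 / 2) ^ k * wt k) := by
        intro n
        rw [← Finset.mul_sum, id, L.P_succ, Nat.add_sub_cancel_left]
        exact mul_le_mul_of_nonneg_left (L.sum_profilePow_range_le A k (n + 1))
          (L.testPow_nonneg k n)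
      refine Real.rpow_le_rpow (Finset.sum_nonneg fun n _ => Finset.sum_nonneg fun r _ => ?_) ?_ hip
      · refine mul_nonneg (L.testPow_nonneg k n) ?_
        split_ifs
        · exact L.profilePow_nonneg A r
        · exact le_rfl
      · refine (Finset.sum_le_sum fun n _ => hle n).trans ?_
        rw [← Finset.sum_mul]
        refine (mul_le_mul_of_nonneg_right (L.sum_testPow_le k G)
          (mul_nonneg (by positivity) (wt_pos k).le)).trans_eq ?_
        have := (wt_pos k).ne'
        field_simp

open Classical in
/-- The sequence of coefficients made of the test vectors with indices in `T`. -/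
def testSeq (T : Set ℕ) (n : ℕ) : ℝ := ∑ k ∈ (Finset.range n).filter (· ∈ T), L.test k n

theorem lt_of_mem_dyadic {k n : ℕ} (hn : n ∈ dyadic (L.K k)) : k < n :=
  ((L.strictMono_K.le_apply (x := k)).trans_lt Nat.lt_two_pow_self).trans_le
    (Finset.mem_Ico.1 hn).1

theorem testSeq_eq (hp : 1 < p) {T : Set ℕ} {k n : ℕ} (hk : k ∈ T) (hn : n ∈ dyadic (L.K k)) :
    L.testSeq T n = L.test k n := by
  classical
  refine Finset.sum_eq_single_of_mem k
    (Finset.mem_filter.2 ⟨Finset.mem_range.2 (L.lt_of_mem_dyadic hn), hk⟩) fun j _ hjk => ?_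
  exact L.test_eq_zero hp fun h => hjk (L.strictMono_K.injective (dyadic_disjoint h hn))

end Layout

/-! ### Gluing the test vectors into separating series -/

namespace Layout

variable {p : Set.Ioi (1 : ℝ)} {γ : Set.Ioo (0 : ℝ) 1} (L : Layout (p : ℝ))

theorem not_seriesConverges {A T : Set ℕ} (hT : T.Infinite) (hTA : T ⊆ A) :
    ¬ SeriesConverges (fun n => tirilmanEmb p γ (L.blockVec A n)) (L.testSeq T) := by
  rw [seriesConverges_tirilmanEmb_iff]
  intro h
  obtain ⟨M, hM⟩ := h ((γ : ℝ) ^ 2) (pow_pos γ.2.1 2)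
  -- On the dyadic interval of such a k, the Cauchy increment is exactly the k-th test vector, of
  -- norm at least γ².
  obtain ⟨k, hk, hMk⟩ := hT.exists_gt M
  have h1 : M ≤ 2 ^ L.K k := hMk.le.trans
    ((L.strictMono_K.le_apply (x := k)).trans Nat.lt_two_pow_self.le)
  have h2 := hM (2 ^ L.K k) (2 ^ (L.K k + 1)) h1 (Nat.pow_le_pow_right two_pos (Nat.le_succ _))
  have h3 : ∑ n ∈ Finset.Ico (2 ^ L.K k) (2 ^ (L.K k + 1)), L.testSeq T n • L.blockVec A n =
      ∑ n ∈ dyadic (L.K k), L.test k n • L.blockVec A n :=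
    Finset.sum_congr rfl fun n hn => by rw [L.testSeq_eq p.2 hk hn]
  rw [h3] at h2
  exact absurd h2 (not_lt.2 (L.le_tirilmanNorm_test p.2 γ.2.1 γ.2.2 (hTA hk)))

theorem seriesConverges (hγ : (γ : ℝ) * (2 * (p : ℝ).conjExponent) ≤ 1) {A T : Set ℕ}
    (hTA : Disjoint T A) :
    SeriesConverges (fun n => tirilmanEmb p γ (L.blockVec A n)) (L.testSeq T) := by
  classical
  rw [seriesConverges_tirilmanEmb_iff]
  intro ε hε
  obtain ⟨k₀, hk₀⟩ := exists_sum_Ico_lt_of_summable ((summable_geometric_of_lt_one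
    (by positivity) (half_rpow_lt_one p.2)).mul_left 2) hε
  refine ⟨2 ^ L.K k₀, fun m n hm hmn => ?_⟩
  -- Beyond 2^(K k₀) only dyadic intervals with k ≥ k₀ are met, so the increment is a finite sum of
  -- restricted test vectors, bounded by the tail of a geometric series.
  have hzero : ∀ j ∈ Finset.Ico m n, ∀ k, ¬ (k₀ ≤ k ∧ k < j) → L.test k j = 0 := by
    intro j hj k hk
    refine L.test_eq_zero p.2 fun hjk => hk ⟨?_, L.lt_of_mem_dyadic hjk⟩
    by_contra hlt
    have h1 := L.strictMono_K (not_le.1 hlt)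
    have h2 : 2 ^ (L.K k + 1) ≤ 2 ^ L.K k₀ := Nat.pow_le_pow_right two_pos h1
    have h3 := (Finset.mem_Ico.1 hjk).2
    have h4 := (Finset.mem_Ico.1 hj).1
    omega
  have hseq : ∀ j ∈ Finset.Ico m n, L.testSeq T j =
      ∑ k ∈ (Finset.Ico k₀ n).filter (· ∈ T), L.test k j := by
    intro j hj
    have hjn := (Finset.mem_Ico.1 hj).2
    rw [testSeq, ← Finset.sum_subset (s₁ := (Finset.Ico k₀ j).filter (· ∈ T)),
      ← Finset.sum_subset (s₁ := (Finset.Ico k₀ j).filter (· ∈ T))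
        (s₂ := (Finset.Ico k₀ n).filter (· ∈ T))]
    · exact Finset.filter_subset_filter _ (Finset.Ico_subset_Ico_right hjn.le)
    · intro k hk hk'
      refine hzero j hj k fun h => hk' ?_
      exact Finset.mem_filter.2 ⟨Finset.mem_Ico.2 h, (Finset.mem_filter.1 hk).2⟩
    · refine Finset.filter_subset_filter _ fun k hk => ?_
      exact Finset.mem_range.2 (Finset.mem_Ico.1 hk).2
    · intro k hk hk'
      refine hzero j hj k fun h => hk' ?_
      exact Finset.mem_filter.2 ⟨Finset.mem_Ico.2 h, (Finset.mem_filter.1 hk).2⟩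
  have hsum : ∑ j ∈ Finset.Ico m n, L.testSeq T j • L.blockVec A j =
      ∑ k ∈ (Finset.Ico k₀ n).filter (· ∈ T),
        ∑ j ∈ Finset.Ico m n, L.test k j • L.blockVec A j := by
    rw [Finset.sum_comm]
    refine Finset.sum_congr rfl fun j hj => ?_
    rw [hseq j hj, Finset.sum_smul]
  rw [hsum]
  refine ((tirilmanNorm_sum_le p.2 γ.2.1 γ.2.2 _ _).trans ?_).trans_lt (hk₀ k₀ n le_rfl)
  refine (Finset.sum_le_sum fun k hk => L.tirilmanNorm_sum_test_le p.2 γ.2.1 γ.2.2 hγ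
    (Set.disjoint_left.1 hTA (Finset.mem_filter.1 hk).2) _).trans ?_
  exact Finset.sum_le_sum_of_subset_of_nonneg (Finset.filter_subset _ _) fun _ _ _ => by positivity

theorem not_seqEquivalent (hγ : (γ : ℝ) * (2 * (p : ℝ).conjExponent) ≤ 1) {A B : Set ℕ}
    (hAB : (A \ B).Infinite) :
    ¬ SeqEquivalent (fun n => tirilmanEmb p γ (L.blockVec A n))
      (fun n => tirilmanEmb p γ (L.blockVec B n)) := fun h =>
  L.not_seriesConverges hAB Set.sdiff_subset
    ((h _).2 (L.seriesConverges hγ Set.disjoint_sdiff_left))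

end Layout

/-! ### Continuum many index sets -/

/-- A family of sets of natural numbers containing `0`, such that any two of them differ by
infinitely many elements. -/
def spreadSet (σ : Set ℕ) : Set ℕ := {n | n = 0 ∨ ∃ i ∈ σ, ∃ j, n = Nat.pair i j + 1}

theorem zero_mem_spreadSet (σ : Set ℕ) : 0 ∈ spreadSet σ := Or.inl rfl

/-- All numbers `Nat.pair i j + 1` with this `i` lie in one set and outside the other; the shift by
one keeps them away from the common element 0. -/
theorem infinite_spreadSet_diff {σ τ : Set ℕ} {i : ℕ} (hσ : i ∈ σ) (hτ : i ∉ τ) :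
    (spreadSet σ \ spreadSet τ).Infinite := by
  refine Set.infinite_of_injective_forall_mem (f := fun j => Nat.pair i j + 1)
    (fun j j' h => ?_) fun j => ⟨Or.inr ⟨i, hσ, j, rfl⟩, ?_⟩
  · exact (Nat.pair_eq_pair.1 (Nat.succ_injective h)).2
  · rintro (h | ⟨i', hi', j', h⟩)
    · exact Nat.succ_ne_zero _ h
    · exact hτ ((Nat.pair_eq_pair.1 (Nat.succ_injective h)).1 ▸ hi')

end

theorem corollary2p12 (p : Set.Ioi (1 : ℝ)) :
    ∃ γ₀ : ℝ, 0 < γ₀ ∧ ∀ γ : Set.Ioo (0 : ℝ) 1, (γ : ℝ) < γ₀ →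
      ∃ S : Set (ℕ → Tirilman p γ), Cardinal.mk S = Cardinal.continuum ∧
        (∀ y ∈ S, IsBlockBasis (tirilmanBasis p γ) y ∧ IsSubsymmetric y) ∧
        S.Pairwise fun y z => ¬ SeqEquivalent y z := by
  have hp : (1 : ℝ) < p := p.2
  have hq : 0 < 2 * (p : ℝ).conjExponent := mul_pos two_pos (div_pos (by linarith) (by linarith))
  -- The threshold 1/(2q) is what keeps the ruler estimate stable: q comes from the weak type sum
  -- and 2 bounds the factor 2^(1/p).
  refine ⟨1 / (2 * (p : ℝ).conjExponent), one_div_pos.2 hq, fun γ hγ => ?_⟩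
  have hγ' : (γ : ℝ) * (2 * (p : ℝ).conjExponent) ≤ 1 := ((lt_div_iff₀ hq).1 hγ).le
  obtain ⟨L⟩ := nonempty_layout (p : ℝ)
  let y : Set ℕ → ℕ → Tirilman p γ := fun σ n => tirilmanEmb p γ (L.blockVec (spreadSet σ) n)
  have hne : ∀ σ τ, σ ≠ τ → ¬ SeqEquivalent (y σ) (y τ) := by
    intro σ τ hστ h
    obtain ⟨i, hi⟩ : ∃ i, ¬ (i ∈ σ ↔ i ∈ τ) := by
      by_contra hall
      push Not at hall
      exact hστ (Set.ext hall)
    -- The separating series needs an index missing from the second set, so the two cases exchange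
    -- the roles of the sequences.
    by_cases hiσ : i ∈ σ
    · exact L.not_seqEquivalent hγ' (infinite_spreadSet_diff hiσ fun hτ => hi (by tauto)) h
    · exact L.not_seqEquivalent hγ' (infinite_spreadSet_diff (by tauto : i ∈ τ) hiσ)
        fun a => (h a).symm
  have hinj : Function.Injective y := by
    intro σ τ h
    by_contra hστ
    exact hne σ τ hστ (h ▸ fun _ => Iff.rfl)
  refine ⟨Set.range y, ?_, ?_, ?_⟩
  · rw [Cardinal.mk_range_eq y hinj]
    simp
  · rintro _ ⟨σ, rfl⟩
    exact ⟨L.isBlockBasis γ (zero_mem_spreadSet σ), L.isSubsymmetric γ (zero_mem_spreadSet σ)⟩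
  · rintro _ ⟨σ, rfl⟩ _ ⟨τ, rfl⟩ hστ
    exact hne σ τ fun h => hστ (h ▸ rfl)
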